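/- Let $n\ge 0$, let $D\subset\mathbb C$ be open with coordinate $t$, and let $\pi:\mathsf X\to D$ be a proper holomorphic submersion of a complex manifold of dimension $2n+2$, with fibres $X_t$ (of dimension $2n+1$). For $i=1,2$ let $\mathsf Z_i$ be a complex manifold of dimension $n+1$ with a holomorphic map $g_i:\mathsf Z_i\to\mathsf X$ (for instance the inclusion of a submanifold), such that the fibres $Z_{i,t}$ of $\pi\circ g_i$ are compact of dimension $n$ and have fundamental cycles $[Z_{i,t}]$, that is, finite decompositions into oriented smooth cells, which locally over $D$ depend smoothly on $t$; integrals over $Z_{i,t}$ are integrals over these cycles. Put $Y_t=g_1(Z_{1,t})\cup g_2(Z_{2,t})\subset X_t$. Let $\delta_t\in H_{2n+1}(X_t,Y_t)$, $t\in D$, be a continuous family of classes, given by smooth chains in $X_t$, with boundary $[Z_{2,t}]-[Z_{1,t}]$: locally over $D$, $\delta_t$ is represented by a smooth family of relative chains with boundary $g_{2*}[Z_{2,t}]-g_{1*}[Z_{1,t}]$. Let $\omega$ be a complex valued $C^\infty$ $(2n+1)$-form on $\mathsf X$ and $\alpha=(\alpha_1,\alpha_2)$ a pair of $C^\infty$ $2n$-forms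 $\alpha_i$ on $\mathsf Z_i$, such that $$d\omega=dt\wedge\frac{d\omega}{dt},\qquad g_i^*\omega-d\alpha_i=dt\wedge\frac{\omega|_{\mathsf Y}-d\alpha}{dt}\Big|_{\mathsf Z_i}\quad(i=1,2)$$ for some $C^\infty$ forms $\frac{d\omega}{dt}$ on $\mathsf X$ and $\frac{\omega|_{\mathsf Y}-d\alpha}{dt}$ on $\mathsf Z_1$ and $\mathsf Z_2$, where $dt$ also denotes its pull-backs. Assume that $\int_{Z_{2,t}-Z_{1,t}}\alpha:=\int_{Z_{2,t}}\alpha_2-\int_{Z_{1,t}}\alpha_1$ is a holomorphic function of $t\in D$. Then, for any choice of these forms, $\int_{\delta_t}\omega$ is complex differentiable at every $t\in D$, and $$\frac{\partial}{\partial t}\int_{\delta_t}\omega=\int_{\delta_t}\frac{d\omega}{dt}+\int_{Z_{2,t}}\frac{\omega|_{\mathsf Y}-d\alpha}{dt}-\int_{Z_{1,t}}\frac{\omega|_{\mathsf Y}-d\alpha}{dt}+\frac{\partial}{\partial t}\left(\int_{Z_{2,t}-Z_{1,t}}\alpha\right).$$ -/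

import Mathlib

open Set Topology
open scoped Manifold ContDiff

noncomputable section

namespace Periods

/-! ### Singular cubical chains

The constructions of this section are set-theoretic.  A cube in the function space `T → M` is the
same thing as a family of cubes in `M` parametrized by `T`, so that they also apply to families of
chains. -/

/-- The unit cube of dimension `k`. -/
abbrev Cube (k : ℕ) : Type := Fin k → unitInterval

/-- Cubical `k`-chains with integer coefficients: formal sums of maps from the `k`-cube to `X`. -/
abbrev Chain (k : ℕ) (X : Type*) : Type _ := (Cube k → X) →₀ ℤ

section Chains

variable {X Y : Type*}

/-- The face `x_i = a` of a cube. -/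
def face {k : ℕ} (i : Fin (k + 1)) (a : unitInterval) (s : Cube (k + 1) → X) : Cube k → X :=
  fun x => s (i.insertNth a x)

/-- The boundary operator `∂ s = ∑ᵢ (-1)ⁱ (s|_{xᵢ = 1} - s|_{xᵢ = 0})`, extended linearly. -/
def boundary {k : ℕ} (c : Chain (k + 1) X) : Chain k X :=
  c.sum fun s m => m • ∑ i : Fin (k + 1),
    (-1 : ℤ) ^ (i : ℕ) • (Finsupp.single (face i 1 s) (1 : ℤ) - Finsupp.single (face i 0 s) 1)

/-- A cube is degenerate if it does not depend on one of its coordinates. -/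
def IsDegenerate {k : ℕ} (s : Cube k → X) : Prop :=
  ∃ j : Fin k, ∀ x y : Cube k, (∀ i, i ≠ j → x i = y i) → s x = s y

/-- The group of degenerate chains, by which cubical chains are normalized. -/
def degenerate (k : ℕ) (X : Type*) : AddSubgroup (Chain k X) :=
  AddSubgroup.closure {c | ∃ s : Cube k → X, IsDegenerate s ∧ c = Finsupp.single s 1}

/-- Equality of normalized cubical chains, that is, equality modulo degenerate chains. -/
def ChainEq {k : ℕ} (c c' : Chain k X) : Prop := c - c' ∈ degenerate k X

/-- Cycles of the normalized cubical complex. -/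
def IsCycle : {k : ℕ} → Chain k X → Prop
  | 0, _ => True
  | _ + 1, c => ChainEq (boundary c) 0

/-- The push-forward of a chain by a map. -/
def push {k : ℕ} (h : X → Y) (c : Chain k X) : Chain k Y := c.mapDomain fun s => h ∘ s

/-- The member at the parameter `t` of a family of chains. -/
def member {T : Type*} {k : ℕ} (c : Chain k (T → X)) (t : T) : Chain k X :=
  push (fun f => f t) c

end Chains

/-! ### Smooth chains, differential forms and integration on complex manifolds

Throughout, `E` is the complex vector space on which the complex manifold `M` is modelled. -/

section Forms

variable {E : Type*} [NormedAddCommGroup E] [NormedSpace ℂ E]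
variable {M : Type*} [TopologicalSpace M] [ChartedSpace E M]

/-- The extension of a cube to `ℝᵏ` by the coordinatewise projection to `[0,1]`; only its values
on the cube `Icc 0 1` matter. -/
def cubeExt {X : Type*} {k : ℕ} (s : Cube k → X) : (Fin k → ℝ) → X :=
  fun x => s fun i => projIcc 0 1 zero_le_one (x i)

variable (E) in
/-- A cube is smooth if it is `C^∞` (as a map of real manifolds) on the closed cube. -/
def IsSmoothCube {k : ℕ} (s : Cube k → M) : Prop :=
  ContMDiffOn 𝓘(ℝ, Fin k → ℝ) 𝓘(ℝ, E) ∞ (cubeExt s) (Icc 0 1)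

variable (E) in
/-- `c` is a chain of smooth cubes of `M` with image in the subset `A`. -/
def IsSmoothChainIn {k : ℕ} (A : Set M) (c : Chain k M) : Prop :=
  ∀ s ∈ c.support, IsSmoothCube E s ∧ ∀ x, s x ∈ A

variable (E) in
/-- `c` is a family of chains in the fibres of `p : M → ℂ`, parametrized by the open set `U` of
the base, whose cubes depend smoothly on the parameter: each of them is a `C^∞` map from
`U × [0,1]ᵏ` to `M` over `U`. -/
def IsSmoothFamily {k : ℕ} (p : M → ℂ) {U : TopologicalSpace.Opens ℂ} (c : Chain k (U → M)) :
    Prop :=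
  ∀ s ∈ c.support,
    (∃ S : ℂ × (Fin k → ℝ) → M,
      ContMDiffOn 𝓘(ℝ, ℂ × (Fin k → ℝ)) 𝓘(ℝ, E) ∞ S ((U : Set ℂ) ×ˢ Icc 0 1) ∧
      ∀ (t : U) (x : Cube k), s x t = S (t, fun i => (x i : ℝ))) ∧
    ∀ (t : U) (x : Cube k), p (s x t) = t

variable (E M) in
/-- A complex valued `C^∞` differential form of degree `k` on `M`, given by its local
representatives in the charts of the atlas, which are transformed into each other by pull-back
along the changes of charts. -/
structure DiffForm (k : ℕ) where
  /-- The representative in a chart; only its values on the target of the chart matter. -/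
  rep : OpenPartialHomeomorph M E → E → E [⋀^Fin k]→L[ℝ] ℂ
  smooth : ∀ φ ∈ atlas E M, ContDiffOn ℝ ∞ (rep φ) φ.target
  compat : ∀ φ ∈ atlas E M, ∀ ψ ∈ atlas E M, ∀ y ∈ φ.target, φ.symm y ∈ ψ.source →
    rep φ y =
      (rep ψ (ψ (φ.symm y))).compContinuousLinearMap (fderiv ℝ (fun u => ψ (φ.symm u)) y)

/-- The value of the pull-back `s^* θ` at the point `x` of the cube, evaluated on the standard
basis of `ℝᵏ`. -/
def DiffForm.pullbackCube {k : ℕ} (θ : DiffForm E M k) (s : Cube k → M) (x : Fin k → ℝ) : ℂ :=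
  let φ := chartAt E (cubeExt s x)
  θ.rep φ (φ (cubeExt s x)) fun i =>
    fderivWithin ℝ (fun u => φ (cubeExt s u)) (Icc 0 1) x (Pi.single i 1)

/-- The integral of a `k`-form over a `k`-chain. -/
def DiffForm.integral {k : ℕ} (θ : DiffForm E M k) (c : Chain k M) : ℂ :=
  c.sum fun s m => (m : ℂ) * ∫ x in Icc (0 : Fin k → ℝ) 1, θ.pullbackCube s x

/-- The exterior product `a ∧ θ` of a `1`-form and a `k`-form (on a vector space):
`(a ∧ θ)(v₀, …, v_k) = ∑ᵢ (-1)ⁱ a(vᵢ) θ(v₀, …, v̂ᵢ, …, v_k)`. -/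
def wedge {k : ℕ} (a : E →L[ℝ] ℂ) (θ : E [⋀^Fin k]→L[ℝ] ℂ) : E [⋀^Fin (k + 1)]→L[ℝ] ℂ :=
  ContinuousAlternatingMap.alternatizeUncurryFin (a.smulRight θ)

/-- `dw = dt ∧ η`, where `t` is the function `p` on `M`; that is, `η` is a form `dw/dt`. -/
def IsExtDerivDivBy {k : ℕ} (p : M → ℂ) (w η : DiffForm E M k) : Prop :=
  ∀ φ ∈ atlas E M, ∀ y ∈ φ.target,
    extDeriv (w.rep φ) y = wedge (fderiv ℝ (fun u => p (φ.symm u)) y) (η.rep φ y)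

variable {F : Type*} [NormedAddCommGroup F] [NormedSpace ℂ F]
variable {Z : Type*} [TopologicalSpace Z] [ChartedSpace F Z]

/-- `g^* w - dα = dt ∧ β` on `Z`, where `g : Z → M` and `t` is the function `p ∘ g` on `Z`; that
is, `β` is a form `(w|_Z - dα)/dt`. -/
def IsRestrictionDivBy {k : ℕ} (p : M → ℂ) (g : Z → M) (w : DiffForm E M (k + 1))
    (α β : DiffForm F Z k) : Prop :=
  ∀ φ ∈ atlas F Z, ∀ ψ ∈ atlas E M, ∀ y ∈ φ.target, g (φ.symm y) ∈ ψ.source →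
    (w.rep ψ (ψ (g (φ.symm y)))).compContinuousLinearMap
        (fderiv ℝ (fun u => ψ (g (φ.symm u))) y) - extDeriv (α.rep φ) y =
      wedge (fderiv ℝ (fun u => p (g (φ.symm u))) y) (β.rep φ y)

/-! ### Fundamental cycles -/

/-- The isomorphism `ℝ²ⁿ → ℂⁿ` sending `x` to `(x₀ + i x₁, x₂ + i x₃, …)`, which defines the
orientation of `ℂⁿ`. -/
def complexCoords {n : ℕ} (x : Fin (2 * n) → ℝ) : Fin n → ℂ :=
  fun j => (x ⟨2 * j, by omega⟩ : ℂ) + Complex.I * (x ⟨2 * j + 1, by omega⟩ : ℂ)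

/-- The real linear map `L : ℝ²ⁿ → F` is an isomorphism onto a complex subspace of dimension `n`,
and it preserves (`e = 1`) or reverses (`e = -1`) the orientation, where the subspace has its
complex orientation: `L = J ∘ complexCoords ∘ B`, where `J : ℂⁿ → F` is complex linear and
injective and `B` is an automorphism of `ℝ²ⁿ` whose determinant has the sign `e`. -/
def HasOrientationSign {n : ℕ} (e : ℤˣ) (L : (Fin (2 * n) → ℝ) →L[ℝ] F) : Prop :=
  ∃ (J : (Fin n → ℂ) →ₗ[ℂ] F) (B : (Fin (2 * n) → ℝ) →ₗ[ℝ] (Fin (2 * n) → ℝ)),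
    Function.Injective J ∧ 0 < ((e : ℤ) : ℝ) * LinearMap.det B ∧
      ∀ v, L v = J (complexCoords (B v))

/-- The interior of the unit cube. -/
def openCube (k : ℕ) : Set (Cube k) := {x | ∀ i, 0 < x i ∧ x i < 1}

variable (F) in
/-- `c` is a fundamental cycle of the `n`-dimensional compact complex space `A ⊆ Z`: it is the
signed sum of the cells of a decomposition of `A` into finitely many smooth cubes of real dimension
`2n` with disjoint interiors, embedded on their interiors, the signs comparing the orientations of
the cubes with the complex orientation, and it is a cycle. -/
def IsFundamentalCycle {n : ℕ} (A : Set Z) (c : Chain (2 * n) Z) : Prop :=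
  IsCycle c ∧
  ∃ (N : ℕ) (s : Fin N → Cube (2 * n) → Z) (e : Fin N → ℤˣ),
    c = ∑ l, Finsupp.single (s l) ((e l : ℤˣ) : ℤ) ∧
    (∀ l, IsSmoothCube F (s l)) ∧
    (⋃ l, range (s l)) = A ∧
    (∀ l l', ∀ x ∈ openCube (2 * n), ∀ x' ∈ openCube (2 * n),
      s l x = s l' x' → l = l' ∧ x = x') ∧
    ∀ l, ∀ x ∈ openCube (2 * n),
      HasOrientationSign (e l)
        (fderivWithin ℝ (fun u => chartAt F (s l x) (cubeExt (s l) u)) (Icc 0 1)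
          fun i => (x i : ℝ))

/-! ### Relative homology -/

variable (E) in
/-- The `k`-chains `c` and `c'` have the same class in the relative homology of the pair `(A, B)`,
where `B ⊆ A ⊆ M`: up to degenerate chains, `c - c'` is the sum of the boundary of a smooth chain
in `A` and of a smooth chain in `B`. -/
def RelHomologous {k : ℕ} (A B : Set M) (c c' : Chain k M) : Prop :=
  ∃ (τ : Chain (k + 1) M) (ε : Chain k M),
    IsSmoothChainIn E A τ ∧ IsSmoothChainIn E B ε ∧ ChainEq (c - c') (boundary τ + ε)

end Forms

section Homology

variable {E : Type*} [NormedAddCommGroup E] [NormedSpace ℂ E]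
variable {X : Type*} [TopologicalSpace X] [ChartedSpace E X]
variable {F₁ : Type*} [NormedAddCommGroup F₁] [NormedSpace ℂ F₁]
variable {Z₁ : Type*} [TopologicalSpace Z₁] [ChartedSpace F₁ Z₁]
variable {F₂ : Type*} [NormedAddCommGroup F₂] [NormedSpace ℂ F₂]
variable {Z₂ : Type*} [TopologicalSpace Z₂] [ChartedSpace F₂ Z₂]

/-- The fibre of `π` over `t`. -/
def fibre (π : X → ℂ) (t : ℂ) : Set X := π ⁻¹' {t}

/-- The union `Y_t` of the images in `X_t` of the fibres `Z_{1,t}` and `Z_{2,t}`. -/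
def unionFibre (π : X → ℂ) (g₁ : Z₁ → X) (g₂ : Z₂ → X) (t : ℂ) : Set X :=
  g₁ '' fibre (π ∘ g₁) t ∪ g₂ '' fibre (π ∘ g₂) t

variable (E F₁ F₂) in
/-- `δ_t`, for `t ∈ D`, is a continuous family of classes in `H_{k+1}(X_t, Y_t)` whose
boundary is the class of `z_{2,t} - z_{1,t}`.  Every `δ t` is a smooth chain in `X_t`, and locally
over `D` there is a family `σ` of chains in the fibres of `π`, depending smoothly on `t`, with
`∂ σ = g₂ z₂ - g₁ z₁` (where `z₁`, `z₂` are also smooth families, of cycles) such that `δ t` and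
`σ t` have the same class in `H_{k+1}(X_t, Y_t)`. -/
def IsHomologyBetween {k : ℕ} (D : Set ℂ) (π : X → ℂ) (g₁ : Z₁ → X) (g₂ : Z₂ → X)
    (z₁ : ℂ → Chain k Z₁) (z₂ : ℂ → Chain k Z₂) (δ : ℂ → Chain (k + 1) X) : Prop :=
  (∀ t ∈ D, IsSmoothChainIn E (fibre π t) (δ t)) ∧
  ∀ t₁ ∈ D, ∃ U : TopologicalSpace.Opens ℂ, t₁ ∈ U ∧ (U : Set ℂ) ⊆ D ∧
    ∃ (σ : Chain (k + 1) (U → X)) (ζ₁ : Chain k (U → Z₁)) (ζ₂ : Chain k (U → Z₂)),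
      IsSmoothFamily E π σ ∧ IsSmoothFamily F₁ (π ∘ g₁) ζ₁ ∧ IsSmoothFamily F₂ (π ∘ g₂) ζ₂ ∧
      IsCycle ζ₁ ∧ IsCycle ζ₂ ∧
      ChainEq (boundary σ) (push (fun f => g₂ ∘ f) ζ₂ - push (fun f => g₁ ∘ f) ζ₁) ∧
      ∀ t : U, z₁ t = member ζ₁ t ∧ z₂ t = member ζ₂ t ∧
        RelHomologous E (fibre π t) (unionFibre π g₁ g₂ t) (δ t) (member σ t)

end Homology

end Periods

end

noncomputable section

namespace Periods

/-! ### Linear functionals on chains -/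

section ChainFunctionals

variable {X Y : Type*} {k : ℕ}

/-! Near a point of `D`, the chain `δ` may be replaced by the smooth family `σ` homologous to it. On
the fibres `dt = 0`, so `w` is closed there. Applying `d` to `dw = dt ∧ η` gives `dt ∧ dη = 0`, and
since `dt` vanishes nowhere on a submersion, `η` is closed on the fibres as well. Moreover `Y_t` is
covered by finitely many smooth `2n`-cubes, so its Hausdorff dimension is at most `2n`, and a smooth
`(2n+1)`-cube inside it has degenerate differential on its interior and integrates every form to
zero. With Stokes' theorem, `w` and `η` therefore have the same integrals over `δ_t` and `σ_t`
(`DiffForm.integral_eq_of_relHomologous`, `DiffForm.cubeIntegral_eq_zero_of_dimH_lt`).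

For the family `σ`, pull `w` back to `U × [0,1]^(2n+1)` and differentiate under the integral in a
real direction `v` of the base. Cartan's formula gives `D_v ∫_σ w = ∫_σ ι_v dw + ∫_∂σ ι_v w`
(`DiffForm.fderiv_familyIntegral_succ`). The first term is `v ∫ η` because `dw = dt ∧ η`. In the
second, `∂σ = g₂ζ₂ - g₁ζ₁` and `gᵢ^*w = dαᵢ + dt ∧ βᵢ`. The summand with `βᵢ` contributes `v ∫ βᵢ`;
the summand `dαᵢ` contributes `D_v ∫ αᵢ`, by Cartan's formula for the cycle `ζᵢ`, whose boundary
term vanishes (`IsRestrictionDivBy.flux_eq`).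

So the real derivative is `v` times a number plus `D_v (∫ α₂ - ∫ α₁)`. The last term is complex
linear in `v` by holomorphy, hence so is the whole, and a complex linear real derivative is a
complex derivative (`hasDerivAt_familyIntegral`).

Families are chains in a function space, so the relation between `∂σ` and the `ζᵢ` holds for whole
families modulo degenerate ones, on which the boundary term of Cartan's formula vanishes. -/

theorem linearCombination_boundary (I : (Cube k → X) → ℂ) (c : Chain (k + 1) X) :
    Finsupp.linearCombination ℤ I (boundary c) =
      Finsupp.linearCombination ℤ (fun s => ∑ i : Fin (k + 1),
        (-1 : ℂ) ^ (i : ℕ) * (I (face i 1 s) - I (face i 0 s))) c := by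
  unfold boundary
  rw [map_finsuppSum, Finsupp.linearCombination_apply]
  refine Finsupp.sum_congr fun s _ => ?_
  rw [map_zsmul, map_sum]
  congr 1
  refine Finset.sum_congr rfl fun i _ => ?_
  rw [map_zsmul, map_sub, Finsupp.linearCombination_single, Finsupp.linearCombination_single]
  simp [zsmul_eq_mul]

/-- Such a functional descends to normalized chains. It is used for integrals over cubes and, on
families, for the boundary term of Cartan's formula. -/
theorem linearCombination_eq_of_chainEq {I : (Cube k → X) → ℂ}
    (hI : ∀ s, IsDegenerate s → I s = 0) {c c' : Chain k X} (h : ChainEq c c') :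
    Finsupp.linearCombination ℤ I c = Finsupp.linearCombination ℤ I c' := by
  rw [← sub_eq_zero, ← map_sub]
  have hle : degenerate k X ≤ (Finsupp.linearCombination ℤ I).toAddMonoidHom.ker := by
    refine (AddSubgroup.closure_le _).2 ?_
    rintro _ ⟨s, hs, rfl⟩
    simp [AddMonoidHom.mem_ker, hI s hs]
  exact hle h

theorem linearCombination_push (I : (Cube k → Y) → ℂ) (h : X → Y) (c : Chain k X) :
    Finsupp.linearCombination ℤ I (push h c) =
      Finsupp.linearCombination ℤ (fun s => I (h ∘ s)) c := by
  unfold push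
  rw [Finsupp.linearCombination_mapDomain]
  rfl

theorem linearCombination_congr {I J : (Cube k → X) → ℂ} {c : Chain k X}
    (h : ∀ s ∈ c.support, I s = J s) :
    Finsupp.linearCombination ℤ I c = Finsupp.linearCombination ℤ J c := by
  rw [Finsupp.linearCombination_apply, Finsupp.linearCombination_apply]
  exact Finsupp.sum_congr fun s hs => by rw [h s hs]

theorem linearCombination_fun_add (I J : (Cube k → X) → ℂ) (c : Chain k X) :
    Finsupp.linearCombination ℤ (fun s => I s + J s) c =
      Finsupp.linearCombination ℤ I c + Finsupp.linearCombination ℤ J c := by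
  simp [Finsupp.linearCombination_apply, Finsupp.sum, smul_add, Finset.sum_add_distrib]

theorem linearCombination_fun_const_mul (a : ℂ) (I : (Cube k → X) → ℂ) (c : Chain k X) :
    Finsupp.linearCombination ℤ (fun s => a * I s) c =
      a * Finsupp.linearCombination ℤ I c := by
  simp [Finsupp.linearCombination_apply, Finsupp.sum, Finset.mul_sum, mul_left_comm]

end ChainFunctionals

/-! ### Pull-back of differential forms -/

section Pullback

variable {E : Type*} [NormedAddCommGroup E] [NormedSpace ℂ E]
variable {M : Type*} [TopologicalSpace M] [ChartedSpace E M]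
variable {V W : Type*} [NormedAddCommGroup V] [NormedSpace ℝ V]
  [NormedAddCommGroup W] [NormedSpace ℝ W]
variable {m : ℕ}

variable (E M) in
theorem isManifold_real [IsManifold 𝓘(ℂ, E) ∞ M] : IsManifold 𝓘(ℝ, E) ∞ M := by
  refine isManifold_of_contDiffOn _ _ _ fun e e' he he' => ?_
  have h : e.symm.trans e' ∈ contDiffGroupoid ∞ 𝓘(ℂ, E) :=
    (contDiffGroupoid ∞ 𝓘(ℂ, E)).compatible he he'
  exact (mem_groupoid_of_pregroupoid.1 h).1.restrict_scalars ℝ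

theorem contMDiff_real {E' : Type*} [NormedAddCommGroup E'] [NormedSpace ℂ E']
    {M' : Type*} [TopologicalSpace M'] [ChartedSpace E' M'] {f : M → M'}
    (hf : ContMDiff 𝓘(ℂ, E) 𝓘(ℂ, E') ∞ f) : ContMDiff 𝓘(ℝ, E) 𝓘(ℝ, E') ∞ f := by
  intro x
  have h := contMDiffAt_iff.1 (hf x)
  exact contMDiffAt_iff.2 ⟨h.1, h.2.restrict_scalars ℝ⟩

/-- Induction on the number of arguments: currying off the first one reduces to the evaluation of a
linear map. -/
theorem ContDiffWithinAt.continuousMultilinear_apply {A : V → W [×m]→L[ℝ] ℂ} {b : Fin m → V → W}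
    {Q : Set V} {p : V} {r : WithTop ℕ∞} (hA : ContDiffWithinAt ℝ r A Q p)
    (hb : ∀ i, ContDiffWithinAt ℝ r (b i) Q p) :
    ContDiffWithinAt ℝ r (fun q => A q fun i => b i q) Q p := by
  induction m with
  | zero =>
    have h := (ContinuousMultilinearMap.apply ℝ (fun _ : Fin 0 => W) ℂ 0).contDiff
      |>.comp_contDiffWithinAt hA
    refine h.congr_of_eventuallyEq (Filter.Eventually.of_forall fun q => ?_) ?_ <;>
    · simp only [Function.comp, ContinuousMultilinearMap.apply_apply]
      congr 1
      exact Subsingleton.elim _ _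
  | succ m ih =>
    have h0 := LinearIsometryEquiv.contDiff (𝕜 := ℝ) (E := W [×m + 1]→L[ℝ] ℂ)
      (F := W →L[ℝ] W [×m]→L[ℝ] ℂ) (n := r)
      (continuousMultilinearCurryLeftEquiv ℝ (fun _ : Fin (m + 1) => W) ℂ)
    have h1 : ContDiffWithinAt ℝ r (fun q => (A q).curryLeft) Q p := h0.comp_contDiffWithinAt hA
    have h2 := ih (h1.clm_apply (hb 0)) (fun i => hb i.succ)
    refine h2.congr_of_eventuallyEq (Filter.Eventually.of_forall fun q => ?_) ?_ <;>
    · simp only [ContinuousMultilinearMap.curryLeft_apply]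
      congr 1
      ext i
      refine Fin.cases ?_ (fun i => ?_) i <;> simp

/-- The pull-back of a form on `M` by a map defined on a subset `Q` of a vector space. -/
def DiffForm.pull (θ : DiffForm E M m) (G : V → M) (Q : Set V) (p : V) : V [⋀^Fin m]→L[ℝ] ℂ :=
  (θ.rep (chartAt E (G p)) (chartAt E (G p) (G p))).compContinuousLinearMap
    (fderivWithin ℝ (fun q => chartAt E (G p) (G q)) Q p)

theorem contDiffWithinAt_chart_comp [IsManifold 𝓘(ℝ, E) ∞ M] {G : V → M} {Q : Set V} {p : V}
    (hG : ContMDiffWithinAt 𝓘(ℝ, V) 𝓘(ℝ, E) ∞ G Q p) {φ : OpenPartialHomeomorph M E}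
    (hφ : φ ∈ atlas E M) (hp : G p ∈ φ.source) :
    ContDiffWithinAt ℝ ∞ (fun q => φ (G q)) Q p := by
  have h := (contMDiffOn_of_mem_maximalAtlas (I := 𝓘(ℝ, E)) (n := ∞)
    (IsManifold.subset_maximalAtlas hφ)).contMDiffAt (φ.open_source.mem_nhds hp)
  exact (h.comp_contMDiffWithinAt p hG).contDiffWithinAt

theorem contDiffAt_chart_symm [IsManifold 𝓘(ℝ, E) ∞ M] {φ ψ : OpenPartialHomeomorph M E}
    (hφ : φ ∈ atlas E M) (hψ : ψ ∈ atlas E M) {y : E} (hy : y ∈ φ.target)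
    (hyψ : φ.symm y ∈ ψ.source) : ContDiffAt ℝ ∞ (fun u => ψ (φ.symm u)) y := by
  have h := (contMDiffOn_symm_of_mem_maximalAtlas (I := 𝓘(ℝ, E)) (n := ∞)
    (IsManifold.subset_maximalAtlas hφ)).contMDiffAt (φ.open_target.mem_nhds hy)
  exact contDiffWithinAt_univ.1
    (contDiffWithinAt_chart_comp (contMDiffWithinAt_univ.2 h) hψ hyψ)

/-- Chain rule. -/
theorem fderivWithin_comp_chart [IsManifold 𝓘(ℝ, E) ∞ M] {G : V → M} {Q : Set V} {p : V}
    (hG : ContMDiffWithinAt 𝓘(ℝ, V) 𝓘(ℝ, E) ∞ G Q p) (hQ : UniqueDiffWithinAt ℝ Q p)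
    (hpQ : p ∈ Q) {φ : OpenPartialHomeomorph M E} (hφ : φ ∈ atlas E M) (hp : G p ∈ φ.source)
    {h : M → W} (hh : DifferentiableAt ℝ (fun u => h (φ.symm u)) (φ (G p))) :
    fderivWithin ℝ (fun q => h (G q)) Q p =
      (fderiv ℝ (fun u => h (φ.symm u)) (φ (G p))).comp
        (fderivWithin ℝ (fun q => φ (G q)) Q p) := by
  have h1 : DifferentiableWithinAt ℝ (fun q => φ (G q)) Q p :=
    (contDiffWithinAt_chart_comp hG hφ hp).differentiableWithinAt (by simp)
  rw [← fderiv_comp_fderivWithin (g := fun u => h (φ.symm u)) (f := fun q => φ (G q)) p hh h1 hQ]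
  refine Filter.EventuallyEq.fderivWithin_eq_of_mem ?_ hpQ
  filter_upwards [hG.continuousWithinAt.preimage_mem_nhdsWithin (φ.open_source.mem_nhds hp)]
    with q hq
  simp [φ.left_inv hq]

/-- Independence of the chart: the compatibility of the representatives is matched with the chain
rule for the change of charts. -/
theorem DiffForm.pull_eq [IsManifold 𝓘(ℝ, E) ∞ M] (θ : DiffForm E M m) {G : V → M} {Q : Set V}
    {p : V} (hG : ContMDiffWithinAt 𝓘(ℝ, V) 𝓘(ℝ, E) ∞ G Q p) (hQ : UniqueDiffWithinAt ℝ Q p)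
    (hpQ : p ∈ Q) {φ : OpenPartialHomeomorph M E} (hφ : φ ∈ atlas E M) (hp : G p ∈ φ.source) :
    θ.pull G Q p = (θ.rep φ (φ (G p))).compContinuousLinearMap
      (fderivWithin ℝ (fun q => φ (G q)) Q p) := by
  have hy := (chartAt E (G p)).map_source (mem_chart_source E (G p))
  have hl := (chartAt E (G p)).left_inv (mem_chart_source E (G p))
  unfold DiffForm.pull
  rw [θ.compat _ (chart_mem_atlas E (G p)) φ hφ _ hy (by rwa [hl]), hl,
    fderivWithin_comp_chart hG hQ hpQ (chart_mem_atlas E (G p)) (mem_chart_source E (G p))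
      (h := φ) ((contDiffAt_chart_symm (chart_mem_atlas E (G p)) hφ hy (by rwa [hl])).differentiableAt
        (by simp))]
  rfl

/-- On a neighbourhood of `p`, the pull-back is computed in a fixed chart. -/
theorem DiffForm.pull_eventuallyEq [IsManifold 𝓘(ℝ, E) ∞ M] (θ : DiffForm E M m) {G : V → M}
    {Q : Set V} {p : V} (hG : ContMDiffOn 𝓘(ℝ, V) 𝓘(ℝ, E) ∞ G Q) (hQ : UniqueDiffOn ℝ Q)
    (hpQ : p ∈ Q) {φ : OpenPartialHomeomorph M E} (hφ : φ ∈ atlas E M) (hp : G p ∈ φ.source) :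
    θ.pull G Q =ᶠ[𝓝[Q] p] fun q => (θ.rep φ (φ (G q))).compContinuousLinearMap
      (fderivWithin ℝ (fun q => φ (G q)) Q q) := by
  filter_upwards [(hG p hpQ).continuousWithinAt.preimage_mem_nhdsWithin
    (φ.open_source.mem_nhds hp), self_mem_nhdsWithin] with q hq hqQ
  exact θ.pull_eq (hG q hqQ) (hQ q hqQ) hqQ hφ hq

/-- The integrands are values on constant frames, so smoothness is only needed after evaluation.
Differentiability of the pull-back as a form, which `extDerivWithin` requires, is a separate
statement below. -/
theorem DiffForm.contDiffOn_pull_apply [IsManifold 𝓘(ℝ, E) ∞ M] (θ : DiffForm E M m) {G : V → M}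
    {Q : Set V} (hG : ContMDiffOn 𝓘(ℝ, V) 𝓘(ℝ, E) ∞ G Q) (hQ : UniqueDiffOn ℝ Q) (v : Fin m → V) :
    ContDiffOn ℝ ∞ (fun p => θ.pull G Q p v) Q := by
  intro p hp
  have hc := chart_mem_atlas E (G p)
  have hs := mem_chart_source E (G p)
  have hφ := contDiffWithinAt_chart_comp (hG p hp) hc hs
  have h1 : ContDiffWithinAt ℝ ∞ (fun q => θ.rep (chartAt E (G p)) (chartAt E (G p) (G q))) Q p :=
    ((θ.smooth _ hc).contDiffAt ((chartAt E (G p)).open_target.mem_nhds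
      ((chartAt E (G p)).map_source hs))).comp_contDiffWithinAt p hφ
  have h2 : ContDiffWithinAt ℝ ∞ (fun q =>
      (θ.rep (chartAt E (G p)) (chartAt E (G p) (G q))).toContinuousMultilinearMap) Q p := by
    have h0 := (ContinuousAlternatingMap.toContinuousMultilinearMapLI
      (𝕜 := ℝ) (E := E) (F := ℂ) (ι := Fin m)).contDiff (n := ∞)
    exact h0.comp_contDiffWithinAt h1
  have h3 := ContDiffWithinAt.continuousMultilinear_apply h2 (b := fun i q =>
    fderivWithin ℝ (fun q => chartAt E (G p) (G q)) Q q (v i)) fun i =>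
      (hφ.fderivWithin_right hQ (by simp) hp).clm_apply contDiffWithinAt_const
  have he := θ.pull_eventuallyEq hG hQ hp hc hs
  refine h3.congr_of_eventuallyEq_of_mem ?_ hp
  filter_upwards [he] with q hq
  rw [hq]
  rfl

theorem DiffForm.differentiableOn_pull [IsManifold 𝓘(ℝ, E) ∞ M] (θ : DiffForm E M m) {G : V → M}
    {Q : Set V} (hG : ContMDiffOn 𝓘(ℝ, V) 𝓘(ℝ, E) ∞ G Q) (hQ : UniqueDiffOn ℝ Q) :
    DifferentiableOn ℝ (θ.pull G Q) Q := by
  intro p hp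
  have hc := chart_mem_atlas E (G p)
  have hs := mem_chart_source E (G p)
  have hφ := contDiffWithinAt_chart_comp (hG p hp) hc hs
  have h1 : ContDiffWithinAt ℝ ∞ (fun q => θ.rep (chartAt E (G p)) (chartAt E (G p) (G q))) Q p :=
    ((θ.smooth _ hc).contDiffAt ((chartAt E (G p)).open_target.mem_nhds
      ((chartAt E (G p)).map_source hs))).comp_contDiffWithinAt p hφ
  have h2 : ContDiffWithinAt ℝ ∞ (fderivWithin ℝ (fun q => chartAt E (G p) (G q)) Q) Q p :=
    hφ.fderivWithin_right hQ (by simp) hp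
  have he := θ.pull_eventuallyEq hG hQ hp hc hs
  exact ((h1.differentiableWithinAt (by simp)).continuousAlternatingMapCompContinuousLinearMap
    (h2.differentiableWithinAt (by simp))).congr_of_eventuallyEq he (he.self_of_nhdsWithin hp)

/-- Exterior derivatives commute with pull-backs. -/
theorem DiffForm.extDerivWithin_pull [IsManifold 𝓘(ℝ, E) ∞ M] (θ : DiffForm E M m) {G : V → M}
    {Q : Set V} {p : V} (hG : ContMDiffOn 𝓘(ℝ, V) 𝓘(ℝ, E) ∞ G Q) (hQ : UniqueDiffOn ℝ Q)
    (hQc : Q ⊆ closure (interior Q)) (hp : p ∈ Q) {φ : OpenPartialHomeomorph M E}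
    (hφ : φ ∈ atlas E M) (hpφ : G p ∈ φ.source) :
    extDerivWithin (θ.pull G Q) Q p = (extDeriv (θ.rep φ) (φ (G p))).compContinuousLinearMap
      (fderivWithin ℝ (fun q => φ (G q)) Q p) := by
  have h0 : DifferentiableWithinAt ℝ (θ.rep φ) univ (φ (G p)) :=
    (((θ.smooth _ hφ).contDiffAt (φ.open_target.mem_nhds (φ.map_source hpφ))).differentiableAt
      (by simp)).differentiableWithinAt
  -- At boundary points of `Q` the second derivative is symmetric because `p` is a limit of interior
  -- points.
  have h1 := _root_.extDerivWithin_pullback (r := ∞) (f := fun q => φ (G q)) h0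
    (contDiffWithinAt_chart_comp (hG p hp) hφ hpφ)
    (by rw [minSmoothness_of_isRCLikeNormedField]; exact WithTop.coe_le_coe.2 le_top) hQ (hQc hp) hp
    (mapsTo_univ (fun q => φ (G q)) Q)
  rw [(θ.pull_eventuallyEq hG hQ hp hφ hpφ).extDerivWithin_eq_of_mem hp, h1,
    extDerivWithin_univ]

theorem DiffForm.pull_comp [IsManifold 𝓘(ℝ, E) ∞ M] (θ : DiffForm E M m) {G : V → M}
    {Q : Set V} {h : W → V} {h' : W →L[ℝ] V} {R : Set W} {x : W}
    (hG : ContMDiffWithinAt 𝓘(ℝ, V) 𝓘(ℝ, E) ∞ G Q (h x)) (hR : UniqueDiffWithinAt ℝ R x)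
    (hh : HasFDerivWithinAt h h' R x) (hRQ : MapsTo h R Q) :
    θ.pull (fun y => G (h y)) R x = (θ.pull G Q (h x)).compContinuousLinearMap h' := by
  have h1 := (contDiffWithinAt_chart_comp hG (chart_mem_atlas E (G (h x)))
    (mem_chart_source E (G (h x)))).differentiableWithinAt (by simp)
  have h2 : fderivWithin ℝ (fun y => chartAt E (G (h x)) (G (h y))) R x =
      (fderivWithin ℝ (fun q => chartAt E (G (h x)) (G q)) Q (h x)).comp h' :=
    (h1.hasFDerivWithinAt.comp x hh hRQ).fderivWithin hR
  unfold DiffForm.pull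
  rw [h2]
  rfl

/-- The right side is an explicit alternatization because `V` is only a real space, whereas `wedge`
is defined on complex ones. -/
theorem wedge_compContinuousLinearMap (a : E →L[ℝ] ℂ) (θ : E [⋀^Fin m]→L[ℝ] ℂ) (L : V →L[ℝ] E) :
    (wedge a θ).compContinuousLinearMap L =
      ContinuousAlternatingMap.alternatizeUncurryFin
        ((a.comp L).smulRight (θ.compContinuousLinearMap L)) := by
  ext v
  simp only [wedge, ContinuousAlternatingMap.compContinuousLinearMap_apply,
    ContinuousAlternatingMap.alternatizeUncurryFin_apply]
  rfl

theorem IsExtDerivDivBy.extDerivWithin_pull [IsManifold 𝓘(ℝ, E) ∞ M] {π : M → ℂ}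
    {w η : DiffForm E M m} (h : IsExtDerivDivBy π w η) (hπ : ContMDiff 𝓘(ℝ, E) 𝓘(ℝ, ℂ) ∞ π)
    {G : V → M} {Q : Set V} {p : V} (hG : ContMDiffOn 𝓘(ℝ, V) 𝓘(ℝ, E) ∞ G Q)
    (hQ : UniqueDiffOn ℝ Q) (hQc : Q ⊆ closure (interior Q)) (hp : p ∈ Q) :
    extDerivWithin (w.pull G Q) Q p = ContinuousAlternatingMap.alternatizeUncurryFin
      ((fderivWithin ℝ (fun q => π (G q)) Q p).smulRight (η.pull G Q p)) := by
  have hc := chart_mem_atlas E (G p)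
  have hs := mem_chart_source E (G p)
  have hsy := (contMDiffOn_symm_of_mem_maximalAtlas (I := 𝓘(ℝ, E)) (n := ∞)
    (IsManifold.subset_maximalAtlas hc)).contMDiffAt
      ((chartAt E (G p)).open_target.mem_nhds ((chartAt E (G p)).map_source hs))
  rw [w.extDerivWithin_pull hG hQ hQc hp hc hs, h _ hc _ ((chartAt E (G p)).map_source hs),
    wedge_compContinuousLinearMap, fderivWithin_comp_chart (h := π) (hG p hp) (hQ p hp) hp hc hs]
  · rfl
  · exact ((hπ.contMDiffAt.comp _ hsy).contDiffAt).differentiableAt (by simp)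

theorem IsRestrictionDivBy.pull_eq [IsManifold 𝓘(ℝ, E) ∞ M] {π : M → ℂ}
    {F : Type*} [NormedAddCommGroup F] [NormedSpace ℂ F]
    {Z : Type*} [TopologicalSpace Z] [ChartedSpace F Z] [IsManifold 𝓘(ℝ, F) ∞ Z] {g : Z → M}
    {w : DiffForm E M (m + 1)} {α β : DiffForm F Z m} (h : IsRestrictionDivBy π g w α β)
    (hπ : ContMDiff 𝓘(ℝ, E) 𝓘(ℝ, ℂ) ∞ π) (hg : ContMDiff 𝓘(ℝ, F) 𝓘(ℝ, E) ∞ g)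
    {G : V → Z} {Q : Set V} {p : V} (hG : ContMDiffOn 𝓘(ℝ, V) 𝓘(ℝ, F) ∞ G Q)
    (hQ : UniqueDiffOn ℝ Q) (hQc : Q ⊆ closure (interior Q)) (hp : p ∈ Q) :
    w.pull (fun q => g (G q)) Q p = extDerivWithin (α.pull G Q) Q p +
      ContinuousAlternatingMap.alternatizeUncurryFin
        ((fderivWithin ℝ (fun q => π (g (G q))) Q p).smulRight (β.pull G Q p)) := by
  have hc := chart_mem_atlas F (G p)
  have hs := mem_chart_source F (G p)
  have hc' := chart_mem_atlas E (g (G p))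
  have hs' := mem_chart_source E (g (G p))
  have hl := (chartAt F (G p)).left_inv hs
  have hsy := (contMDiffOn_symm_of_mem_maximalAtlas (I := 𝓘(ℝ, F)) (n := ∞)
    (IsManifold.subset_maximalAtlas hc)).contMDiffAt
      ((chartAt F (G p)).open_target.mem_nhds ((chartAt F (G p)).map_source hs))
  have h0 := h _ hc _ hc' _ ((chartAt F (G p)).map_source hs) (by rwa [hl])
  rw [hl, sub_eq_iff_eq_add'] at h0
  have hgs : ContMDiffAt 𝓘(ℝ, F) 𝓘(ℝ, E) ∞ (fun u => g ((chartAt F (G p)).symm u))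
      (chartAt F (G p) (G p)) := hg.contMDiffAt.comp _ hsy
  have h1 : DifferentiableAt ℝ (fun u => chartAt E (g (G p)) (g ((chartAt F (G p)).symm u)))
      (chartAt F (G p) (G p)) := by
    have := contDiffWithinAt_chart_comp (contMDiffWithinAt_univ.2 hgs) hc' (by rwa [hl])
    exact (contDiffWithinAt_univ.1 this).differentiableAt (by simp)
  have h2 : DifferentiableAt ℝ (fun u => π (g ((chartAt F (G p)).symm u)))
      (chartAt F (G p) (G p)) :=
    ((hπ.contMDiffAt.comp _ hgs).contDiffAt).differentiableAt (by simp)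
  -- The identity in the chart of `Z` is composed with the differential of `G` in that chart; the
  -- chain rule then identifies each term.
  have h3 := congrArg (fun A => A.compContinuousLinearMap
    (fderivWithin ℝ (fun q => chartAt F (G p) (G q)) Q p)) h0
  rw [α.extDerivWithin_pull hG hQ hQc hp hc hs,
    fderivWithin_comp_chart (h := fun z => π (g z)) (hG p hp) (hQ p hp) hp hc hs h2]
  have h4 : w.pull (fun q => g (G q)) Q p =
      (w.rep (chartAt E (g (G p))) (chartAt E (g (G p)) (g (G p)))).compContinuousLinearMap
        (fderivWithin ℝ (fun q => chartAt E (g (G p)) (g (G q))) Q p) := rfl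
  rw [h4, fderivWithin_comp_chart (h := fun z => chartAt E (g (G p)) (g z)) (hG p hp) (hQ p hp) hp
    hc hs h1]
  refine Eq.trans h3 ?_
  exact (map_add (ContinuousAlternatingMap.compContinuousLinearMapCLM _) _ _).trans
    (congrArg _ (wedge_compContinuousLinearMap _ _ _))

end Pullback

/-! ### Calculus on cubes -/

section CubeCalculus

open MeasureTheory

variable {k : ℕ}

theorem uniqueDiffOn_box (k : ℕ) : UniqueDiffOn ℝ (Icc (0 : Fin k → ℝ) 1) := by
  rw [← pi_univ_Icc]
  exact UniqueDiffOn.univ_pi fun i => uniqueDiffOn_Icc zero_lt_one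

theorem interior_box (k : ℕ) :
    interior (Icc (0 : Fin k → ℝ) 1) = univ.pi fun _ => Ioo 0 1 := by
  rw [← pi_univ_Icc, interior_pi_set finite_univ]
  simp

theorem closure_interior_box (k : ℕ) :
    closure (interior (Icc (0 : Fin k → ℝ) 1)) = Icc 0 1 := by
  rw [interior_box, closure_pi_set, ← pi_univ_Icc]
  simp [closure_Ioo (zero_ne_one (α := ℝ))]

theorem ae_mem_interior_box (k : ℕ) :
    ∀ᵐ x ∂volume.restrict (Icc (0 : Fin k → ℝ) 1), x ∈ interior (Icc (0 : Fin k → ℝ) 1) := by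
  have h : (univ.pi fun _ : Fin k => Ioo (0 : ℝ) 1) =ᵐ[volume] Icc (0 : Fin k → ℝ) 1 :=
    Measure.univ_pi_Ioo_ae_eq_Icc (f := fun _ => (0 : ℝ)) (g := fun _ => 1)
  rw [← Measure.restrict_congr_set h, interior_box]
  exact ae_restrict_mem (MeasurableSet.univ_pi fun _ => measurableSet_Ioo)

theorem uniqueDiffOn_family (U : TopologicalSpace.Opens ℂ) (k : ℕ) :
    UniqueDiffOn ℝ ((U : Set ℂ) ×ˢ Icc (0 : Fin k → ℝ) 1) :=
  U.isOpen.uniqueDiffOn.prod (uniqueDiffOn_box k)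

theorem subset_closure_interior_family (U : TopologicalSpace.Opens ℂ) (k : ℕ) :
    (U : Set ℂ) ×ˢ Icc (0 : Fin k → ℝ) 1 ⊆
      closure (interior ((U : Set ℂ) ×ˢ Icc (0 : Fin k → ℝ) 1)) := by
  rw [interior_prod_eq, closure_prod_eq, closure_interior_box, U.isOpen.interior_eq]
  exact prod_mono subset_closure le_rfl

/-- The divergence theorem on the unit cube. -/
theorem integral_sum_fderivWithin_box {h : Fin (k + 1) → (Fin (k + 1) → ℝ) → ℂ}
    (hh : ∀ i, ContDiffOn ℝ 1 (h i) (Icc 0 1)) :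
    ∫ x in Icc (0 : Fin (k + 1) → ℝ) 1, ∑ i : Fin (k + 1),
        (-1 : ℂ) ^ (i : ℕ) * fderivWithin ℝ (h i) (Icc 0 1) x (Pi.single i 1) =
      ∑ i : Fin (k + 1), (-1 : ℂ) ^ (i : ℕ) *
        ((∫ y in Icc (0 : Fin k → ℝ) 1, h i (i.insertNth 1 y)) -
          ∫ y in Icc (0 : Fin k → ℝ) 1, h i (i.insertNth 0 y)) := by
  have key := integral_divergence_of_hasFDerivAt_off_countable' (a := (0 : Fin (k + 1) → ℝ))
    (b := 1) zero_le_one (fun i x => (-1 : ℂ) ^ (i : ℕ) * h i x)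
    (fun i x => (-1 : ℂ) ^ (i : ℕ) • fderivWithin ℝ (h i) (Icc 0 1) x) ∅ countable_empty
    (fun i => continuousOn_const.mul (hh i).continuousOn) ?_ ?_
  · simp only [smul_apply, smul_eq_mul] at key
    rw [key]
    refine Finset.sum_congr rfl fun i _ => ?_
    rw [integral_const_mul, integral_const_mul, ← mul_sub]
    rfl
  · rintro x ⟨hx, -⟩ i
    have hx' : x ∈ interior (Icc (0 : Fin (k + 1) → ℝ) 1) := by rw [interior_box]; exact hx
    have h1 := ((hh i).differentiableOn one_ne_zero x (interior_subset hx')).hasFDerivWithinAt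
    exact (h1.hasFDerivAt (mem_interior_iff_mem_nhds.1 hx')).const_mul _
  · refine ContinuousOn.integrableOn_Icc (continuousOn_finsetSum _ fun i _ => ?_)
    have h1 := (hh i).continuousOn_fderivWithin (uniqueDiffOn_box _) le_rfl
    simp only [smul_apply, smul_eq_mul]
    exact continuousOn_const.mul (h1.clm_apply continuousOn_const)

/-- Stokes' theorem on the unit cube. -/
theorem integral_extDerivWithin_box {Θ : (Fin (k + 1) → ℝ) → (Fin (k + 1) → ℝ) [⋀^Fin k]→L[ℝ] ℂ}
    (hΘ : DifferentiableOn ℝ Θ (Icc 0 1))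
    (hΘv : ∀ v, ContDiffOn ℝ 1 (fun x => Θ x v) (Icc 0 1)) :
    ∫ x in Icc (0 : Fin (k + 1) → ℝ) 1,
        extDerivWithin Θ (Icc 0 1) x (fun i => Pi.single i 1) =
      ∑ i : Fin (k + 1), (-1 : ℂ) ^ (i : ℕ) *
        ((∫ y in Icc (0 : Fin k → ℝ) 1,
            Θ (i.insertNth 1 y) (fun j => Pi.single (i.succAbove j) 1)) -
          ∫ y in Icc (0 : Fin k → ℝ) 1,
            Θ (i.insertNth 0 y) (fun j => Pi.single (i.succAbove j) 1)) := by
  rw [← integral_sum_fderivWithin_box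
    (h := fun i x => Θ x (fun j => Pi.single (i.succAbove j) 1)) (fun i => hΘv _)]
  refine setIntegral_congr_fun measurableSet_Icc fun x hx => ?_
  rw [extDerivWithin_apply (hΘ x hx) (uniqueDiffOn_box _ x hx)]
  refine Finset.sum_congr rfl fun i _ => ?_
  simp only [zsmul_eq_mul, Int.cast_pow, Int.cast_neg, Int.cast_one]
  rfl

variable {U : TopologicalSpace.Opens ℂ} {f : ℂ × (Fin k → ℝ) → ℂ}

/-- Differentiation under the integral sign over the unit cube. -/
theorem hasFDerivAt_integral_box
    (hf : ContDiffOn ℝ 1 f ((U : Set ℂ) ×ˢ Icc 0 1)) {t : ℂ} (ht : t ∈ U) :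
    HasFDerivAt (fun u => ∫ x in Icc (0 : Fin k → ℝ) 1, f (u, x))
      (∫ x in Icc (0 : Fin k → ℝ) 1,
        (fderivWithin ℝ f ((U : Set ℂ) ×ˢ Icc 0 1) (t, x)).comp
          (ContinuousLinearMap.inl ℝ ℂ (Fin k → ℝ))) t := by
  obtain ⟨r, hr, hrU⟩ := Metric.nhds_basis_closedBall.mem_iff.1 (U.isOpen.mem_nhds ht)
  have hD : ContinuousOn (fun p => (fderivWithin ℝ f ((U : Set ℂ) ×ˢ Icc 0 1) p).comp
      (ContinuousLinearMap.inl ℝ ℂ (Fin k → ℝ))) ((U : Set ℂ) ×ˢ Icc 0 1) :=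
    (hf.continuousOn_fderivWithin (uniqueDiffOn_family U k) le_rfl).clm_comp continuousOn_const
  -- Compactness of the ball times the cube provides the constant that dominates the derivative.
  obtain ⟨C, hC⟩ := ((isCompact_closedBall t r).prod
    (isCompact_Icc (a := (0 : Fin k → ℝ)) (b := 1))).exists_bound_of_continuousOn
    (hD.mono (prod_mono hrU le_rfl))
  have hslice : ∀ u ∈ U, MapsTo (fun x : Fin k → ℝ => (u, x)) (Icc 0 1)
      ((U : Set ℂ) ×ˢ Icc 0 1) := fun u hu x hx => ⟨hu, hx⟩
  have hcont : ∀ u ∈ U, ContinuousOn (fun x : Fin k → ℝ => f (u, x)) (Icc 0 1) := fun u hu =>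
    hf.continuousOn.comp (by fun_prop) (hslice u hu)
  refine hasFDerivAt_integral_of_dominated_of_fderiv_le (bound := fun _ => C)
    (F := fun u x => f (u, x))
    (F' := fun u x => (fderivWithin ℝ f ((U : Set ℂ) ×ˢ Icc 0 1) (u, x)).comp
      (ContinuousLinearMap.inl ℝ ℂ (Fin k → ℝ)))
    (Metric.closedBall_mem_nhds t hr) ?_ (hcont t ht).integrableOn_Icc ?_ ?_ ?_ ?_
  · filter_upwards [U.isOpen.mem_nhds ht] with u hu
    exact (hcont u hu).aestronglyMeasurable measurableSet_Icc
  · exact (hD.comp (by fun_prop) (hslice t ht)).aestronglyMeasurable measurableSet_Icc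
  · filter_upwards [ae_restrict_mem measurableSet_Icc] with x hx u hu
    exact hC (u, x) ⟨hu, hx⟩
  · exact continuousOn_const.integrableOn_Icc
  · filter_upwards [ae_restrict_mem measurableSet_Icc] with x hx u hu
    have h1 := (hf.differentiableOn one_ne_zero (u, x) ⟨hrU hu, hx⟩).hasFDerivWithinAt
    have h2 : HasFDerivWithinAt (fun u : ℂ => (u, x))
        (ContinuousLinearMap.inl ℝ ℂ (Fin k → ℝ)) U u :=
      (hasFDerivAt_prodMk_left (𝕜 := ℝ) u x).hasFDerivWithinAt
    exact (h1.comp u h2 (t := (U : Set ℂ) ×ˢ Icc (0 : Fin k → ℝ) 1)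
      fun u hu => ⟨hu, hx⟩).hasFDerivAt (U.isOpen.mem_nhds (hrU hu))

/-- The frame of `ℂ × ℝᵏ` which consists of `(v, 0)` and of the standard basis of `ℝᵏ`. -/
def transverseFrame (k : ℕ) (v : ℂ) : Fin (k + 1) → ℂ × (Fin k → ℝ) :=
  Fin.cons (v, 0) fun i => (0, Pi.single i 1)

variable {Θ : ℂ × (Fin k → ℝ) → (ℂ × (Fin k → ℝ)) [⋀^Fin k]→L[ℝ] ℂ}

theorem differentiableAt_integral_family
    (hΘv : ∀ v, ContDiffOn ℝ 1 (fun p => Θ p v) ((U : Set ℂ) ×ˢ Icc 0 1)) {t : ℂ} (ht : t ∈ U) :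
    DifferentiableAt ℝ (fun u => ∫ x in Icc (0 : Fin k → ℝ) 1,
      Θ (u, x) fun i => (0, Pi.single i 1)) t :=
  (hasFDerivAt_integral_box (hΘv _) ht).differentiableAt

/-- Cartan's formula for the derivative of the integral of a form over a family of cubes, with the
boundary term in the form of a divergence. -/
theorem fderiv_integral_family (hΘ : DifferentiableOn ℝ Θ ((U : Set ℂ) ×ˢ Icc 0 1))
    (hΘv : ∀ v, ContDiffOn ℝ 1 (fun p => Θ p v) ((U : Set ℂ) ×ˢ Icc 0 1)) {t : ℂ} (ht : t ∈ U)
    (v : ℂ) :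
    fderiv ℝ (fun u => ∫ x in Icc (0 : Fin k → ℝ) 1, Θ (u, x) fun i => (0, Pi.single i 1)) t v =
      (∫ x in Icc (0 : Fin k → ℝ) 1,
        extDerivWithin Θ ((U : Set ℂ) ×ˢ Icc 0 1) (t, x) (transverseFrame k v)) +
      ∫ x in Icc (0 : Fin k → ℝ) 1, ∑ i : Fin k, (-1 : ℂ) ^ (i : ℕ) *
        fderivWithin ℝ (fun y => Θ (t, y) (i.succ.removeNth (transverseFrame k v))) (Icc 0 1) x
          (Pi.single i 1) := by
  have hslice : MapsTo (fun x : Fin k → ℝ => (t, x)) (Icc 0 1)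
      ((U : Set ℂ) ×ˢ Icc 0 1) := fun x hx => ⟨ht, hx⟩
  have hQ := uniqueDiffOn_family U k
  set f : ℂ × (Fin k → ℝ) → ℂ := fun p => Θ p fun i => (0, Pi.single i 1) with hf
  have hD : ContinuousOn (fun x => (fderivWithin ℝ f ((U : Set ℂ) ×ˢ Icc 0 1) (t, x)).comp
      (ContinuousLinearMap.inl ℝ ℂ (Fin k → ℝ))) (Icc 0 1) :=
    (((hΘv _).continuousOn_fderivWithin hQ le_rfl).clm_comp continuousOn_const).comp
      (by fun_prop) hslice
  have hh : ∀ w, ContDiffOn ℝ 1 (fun y => Θ (t, y) w) (Icc 0 1) := fun w =>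
    (hΘv w).comp (by fun_prop) hslice
  have hS : ContinuousOn (fun x => ∑ i : Fin k, (-1 : ℂ) ^ (i : ℕ) *
      fderivWithin ℝ (fun y => Θ (t, y) (i.succ.removeNth (transverseFrame k v))) (Icc 0 1) x
        (Pi.single i 1)) (Icc 0 1) :=
    continuousOn_finsetSum _ fun i _ => continuousOn_const.mul
      (((hh _).continuousOn_fderivWithin (uniqueDiffOn_box _) le_rfl).clm_apply continuousOn_const)
  have hL : ContinuousOn (fun x => fderivWithin ℝ f ((U : Set ℂ) ×ˢ Icc 0 1) (t, x) (v, 0))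
      (Icc 0 1) := hD.clm_apply continuousOn_const
  -- In the alternating sum for the exterior derivative, index `0` gives the derivative along `v`.
  -- The shift to `i.succ` changes the sign of the remaining terms.
  have hpt : ∀ x ∈ Icc (0 : Fin k → ℝ) 1,
      extDerivWithin Θ ((U : Set ℂ) ×ˢ Icc 0 1) (t, x) (transverseFrame k v) =
      fderivWithin ℝ f ((U : Set ℂ) ×ˢ Icc 0 1) (t, x) (v, 0) - ∑ i : Fin k, (-1 : ℂ) ^ (i : ℕ) *
        fderivWithin ℝ (fun y => Θ (t, y) (i.succ.removeNth (transverseFrame k v))) (Icc 0 1) x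
          (Pi.single i 1) := by
    intro x hx
    have hp : (t, x) ∈ (U : Set ℂ) ×ˢ Icc (0 : Fin k → ℝ) 1 := ⟨ht, hx⟩
    rw [extDerivWithin_apply (hΘ _ hp) (hQ _ hp), Fin.sum_univ_succ, sub_eq_add_neg,
      ← Finset.sum_neg_distrib]
    congr 1
    · have : Fin.removeNth 0 (transverseFrame k v) = fun i => (0, Pi.single i 1) := by
        ext1 i
        simp [Fin.removeNth, transverseFrame]
      rw [this]
      simp [transverseFrame, hf]
    · refine Finset.sum_congr rfl fun i _ => ?_
      have h1 := ((hΘv (i.succ.removeNth (transverseFrame k v))).differentiableOn one_ne_zero _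
        hp).hasFDerivWithinAt
      have h2 := (hasFDerivAt_prodMk_right (𝕜 := ℝ) t x).hasFDerivWithinAt (s := Icc 0 1)
      have h3 : fderivWithin ℝ (fun y => Θ (t, y) (i.succ.removeNth (transverseFrame k v)))
          (Icc 0 1) x = _ := (h1.comp x h2 hslice).fderivWithin (uniqueDiffOn_box k x hx)
      rw [h3]
      simp [transverseFrame, pow_succ]
  rw [(hasFDerivAt_integral_box (hΘv _) ht).fderiv,
    ContinuousLinearMap.integral_apply hD.integrableOn_Icc,
    setIntegral_congr_fun measurableSet_Icc hpt,
    integral_sub hL.integrableOn_Icc hS.integrableOn_Icc, sub_add_cancel]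
  simp [hf]

/-- Cartan's formula for the derivative of the integral of a form over a family of cubes. -/
theorem fderiv_integral_family_succ
    {Θ : ℂ × (Fin (k + 1) → ℝ) → (ℂ × (Fin (k + 1) → ℝ)) [⋀^Fin (k + 1)]→L[ℝ] ℂ}
    (hΘ : DifferentiableOn ℝ Θ ((U : Set ℂ) ×ˢ Icc 0 1))
    (hΘv : ∀ v, ContDiffOn ℝ 1 (fun p => Θ p v) ((U : Set ℂ) ×ˢ Icc 0 1)) {t : ℂ} (ht : t ∈ U)
    (v : ℂ) :
    fderiv ℝ (fun u => ∫ x in Icc (0 : Fin (k + 1) → ℝ) 1,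
        Θ (u, x) fun i => (0, Pi.single i 1)) t v =
      (∫ x in Icc (0 : Fin (k + 1) → ℝ) 1,
        extDerivWithin Θ ((U : Set ℂ) ×ˢ Icc 0 1) (t, x) (transverseFrame (k + 1) v)) +
      ∑ i : Fin (k + 1), (-1 : ℂ) ^ (i : ℕ) *
        ((∫ y in Icc (0 : Fin k → ℝ) 1,
            Θ (t, i.insertNth 1 y) (i.succ.removeNth (transverseFrame (k + 1) v))) -
          ∫ y in Icc (0 : Fin k → ℝ) 1,
            Θ (t, i.insertNth 0 y) (i.succ.removeNth (transverseFrame (k + 1) v))) := by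
  rw [fderiv_integral_family hΘ hΘv ht v]
  congr 1
  exact integral_sum_fderivWithin_box
    (h := fun i y => Θ (t, y) (i.succ.removeNth (transverseFrame (k + 1) v)))
    fun i => (hΘv _).comp (by fun_prop) fun x hx => ⟨ht, hx⟩

end CubeCalculus

/-! ### Integrals over cubes and over families of cubes -/

section CubeIntegrals

open MeasureTheory

variable {E : Type*} [NormedAddCommGroup E] [NormedSpace ℂ E]
variable {M : Type*} [TopologicalSpace M] [ChartedSpace E M]
variable {V : Type*} [NormedAddCommGroup V] [NormedSpace ℝ V]
variable {k : ℕ}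

/-- The linear part of the affine map `y ↦ i.insertNth a y`. -/
def insertZero (i : Fin (k + 1)) : (Fin k → ℝ) →L[ℝ] (Fin (k + 1) → ℝ) :=
  ContinuousLinearMap.pi (i.insertNth (α := fun _ => (Fin k → ℝ) →L[ℝ] ℝ) 0
    fun j => ContinuousLinearMap.proj j)

theorem insertZero_single (i : Fin (k + 1)) (j : Fin k) :
    insertZero i (Pi.single j 1) = Pi.single (i.succAbove j) 1 := by
  ext l
  refine Fin.succAboveCases i ?_ (fun l => ?_) l
  · simp [insertZero, Fin.ne_succAbove]
  · simp [insertZero, Pi.single_apply]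

theorem hasFDerivAt_insertNth (i : Fin (k + 1)) (a : ℝ) (y : Fin k → ℝ) :
    HasFDerivAt (fun y : Fin k → ℝ => (i.insertNth a y : Fin (k + 1) → ℝ)) (insertZero i) y := by
  refine hasFDerivAt_pi'.2 fun l => ?_
  refine Fin.succAboveCases i ?_ (fun l => ?_) l
  · have h : (ContinuousLinearMap.proj (R := ℝ) (φ := fun _ : Fin (k + 1) => ℝ) i).comp
        (insertZero i) = 0 := by
      ext; simp [insertZero]
    simpa [h] using hasFDerivAt_const a y
  · have h : (ContinuousLinearMap.proj (R := ℝ) (φ := fun _ : Fin (k + 1) => ℝ)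
        (i.succAbove l)).comp (insertZero i) = ContinuousLinearMap.proj l := by
      ext; simp [insertZero]
    simpa [h] using hasFDerivAt_apply (𝕜 := ℝ) l y

theorem mapsTo_insertNth_box (i : Fin (k + 1)) (a : unitInterval) :
    MapsTo (fun y : Fin k → ℝ => (i.insertNth (a : ℝ) y : Fin (k + 1) → ℝ)) (Icc 0 1)
      (Icc 0 1) := fun _ hy => Fin.insertNth_mem_Icc.2 ⟨a.2, hy⟩

theorem cubeExt_face {X : Type*} (i : Fin (k + 1)) (a : unitInterval) (s : Cube (k + 1) → X)
    (y : Fin k → ℝ) : cubeExt (face i a s) y = cubeExt s (i.insertNth (a : ℝ) y) := by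
  unfold cubeExt face
  congr 1
  ext1 l
  refine Fin.succAboveCases i ?_ (fun l => ?_) l
  · simp [projIcc_val]
  · simp

theorem IsDegenerate.cubeExt_add_smul {X : Type*} {s : Cube k → X} (hs : IsDegenerate s) :
    ∃ j : Fin k, ∀ (x : Fin k → ℝ) (r : ℝ),
      cubeExt s (x + r • (Pi.single j 1 : Fin k → ℝ)) = cubeExt s x := by
  obtain ⟨j, hj⟩ := hs
  refine ⟨j, fun x r => hj _ _ fun i hi => ?_⟩
  simp [hi]

/-- No differentiability is assumed, since the cubes of a degenerate chain are arbitrary maps; where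
it fails, the derivative is `0` by convention. -/
theorem fderivWithin_eq_zero_of_invariant {f : V → E} {Q : Set V} {p e : V} (hQ : Q ∈ 𝓝 p)
    (h : ∀ r : ℝ, f (p + r • e) = f p) : fderivWithin ℝ f Q p e = 0 := by
  rw [fderivWithin_of_mem_nhds hQ]
  by_cases hf : DifferentiableAt ℝ f p
  · rw [← hf.lineDeriv_eq_fderiv]
    simp [lineDeriv, h]
  · simp [fderiv_zero_of_not_differentiableAt hf]

theorem DiffForm.pull_eq_zero_of_invariant {m : ℕ} (θ : DiffForm E M m) {G : V → M} {Q : Set V}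
    {p : V} (hQ : Q ∈ 𝓝 p) {v : Fin m → V} (j : Fin m) (h : ∀ r : ℝ, G (p + r • v j) = G p) :
    θ.pull G Q p v = 0 := by
  unfold DiffForm.pull
  rw [ContinuousAlternatingMap.compContinuousLinearMap_apply]
  refine ContinuousAlternatingMap.map_coord_zero _ j ?_
  exact fderivWithin_eq_zero_of_invariant hQ fun r => by rw [h]

/-- The integral of a form over a cube. -/
def DiffForm.cubeIntegral (θ : DiffForm E M k) (s : Cube k → M) : ℂ :=
  ∫ x in Icc (0 : Fin k → ℝ) 1, θ.pullbackCube s x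

theorem DiffForm.integral_eq (θ : DiffForm E M k) (c : Chain k M) :
    θ.integral c = Finsupp.linearCombination ℤ θ.cubeIntegral c := by
  rw [Finsupp.linearCombination_apply]
  exact Finsupp.sum_congr fun s _ => by rw [zsmul_eq_mul]; rfl

theorem DiffForm.pullbackCube_eq (θ : DiffForm E M k) (s : Cube k → M) (x : Fin k → ℝ) :
    θ.pullbackCube s x = θ.pull (cubeExt s) (Icc 0 1) x fun i => Pi.single i 1 := rfl

theorem DiffForm.cubeIntegral_of_isDegenerate (θ : DiffForm E M k) (s : Cube k → M)
    (hs : IsDegenerate s) : θ.cubeIntegral s = 0 := by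
  obtain ⟨j, hj⟩ := hs.cubeExt_add_smul
  refine integral_eq_zero_of_ae ?_
  filter_upwards [ae_mem_interior_box k] with x hx
  exact θ.pull_eq_zero_of_invariant (mem_interior_iff_mem_nhds.1 hx) j fun r => hj x r

/-- Stokes' theorem for smooth cubes. -/
theorem DiffForm.sum_cubeIntegral_face [IsManifold 𝓘(ℝ, E) ∞ M] (θ : DiffForm E M k)
    {s : Cube (k + 1) → M} (hs : IsSmoothCube E s) :
    ∑ i : Fin (k + 1), (-1 : ℂ) ^ (i : ℕ) *
        (θ.cubeIntegral (face i 1 s) - θ.cubeIntegral (face i 0 s)) =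
      ∫ x in Icc (0 : Fin (k + 1) → ℝ) 1,
        extDerivWithin (θ.pull (cubeExt s) (Icc 0 1)) (Icc 0 1) x fun i => Pi.single i 1 := by
  rw [integral_extDerivWithin_box (θ.differentiableOn_pull hs (uniqueDiffOn_box _))
    fun v => (θ.contDiffOn_pull_apply hs (uniqueDiffOn_box _) v).of_le (by simp)]
  -- The inclusion of a face carries the standard basis to the one with the `i`-th vector deleted.
  have key : ∀ (i : Fin (k + 1)) (a : unitInterval), θ.cubeIntegral (face i a s) =
      ∫ y in Icc (0 : Fin k → ℝ) 1, θ.pull (cubeExt s) (Icc 0 1) (i.insertNth (a : ℝ) y)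
        fun j => Pi.single (i.succAbove j) 1 := by
    intro i a
    refine setIntegral_congr_fun measurableSet_Icc fun y hy => ?_
    have h := θ.pull_comp (hs _ (mapsTo_insertNth_box i a hy)) (uniqueDiffOn_box k y hy)
      (hasFDerivAt_insertNth i (a : ℝ) y).hasFDerivWithinAt (mapsTo_insertNth_box i a)
    simp only [θ.pullbackCube_eq, funext (cubeExt_face i a s), h,
      ContinuousAlternatingMap.compContinuousLinearMap_apply, Function.comp_def, insertZero_single]
  simp only [key]
  rfl

variable {U : TopologicalSpace.Opens ℂ}

open Classical in
/-- The map on `ℂ × ℝᵏ` defined by a family of cubes. Only its values on `U × [0,1]ᵏ` matter. -/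
def familyExt {X : Type*} (s : Cube k → U → X) (t : U) (p : ℂ × (Fin k → ℝ)) : X :=
  cubeExt s p.2 (if h : p.1 ∈ U then ⟨p.1, h⟩ else t)

theorem familyExt_of_mem {X : Type*} (s : Cube k → U → X) (t u : U) (x : Fin k → ℝ) :
    familyExt s t (u, x) = cubeExt (fun y => s y u) x := by
  simp [familyExt, cubeExt]

theorem IsSmoothFamily.contMDiffOn_familyExt {p : M → ℂ} {c : Chain k (U → M)}
    (hc : IsSmoothFamily E p c) {s : Cube k → U → M} (hs : s ∈ c.support) (t : U) :
    ContMDiffOn 𝓘(ℝ, ℂ × (Fin k → ℝ)) 𝓘(ℝ, E) ∞ (familyExt s t) ((U : Set ℂ) ×ˢ Icc 0 1) := by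
  obtain ⟨⟨S, hS, hSs⟩, -⟩ := hc s hs
  refine hS.congr ?_
  rintro ⟨u, x⟩ ⟨hu, hx⟩
  rw [familyExt_of_mem s t ⟨u, hu⟩, cubeExt, hSs]
  congr 2
  ext i
  simp [projIcc_of_mem zero_le_one (show x i ∈ Icc (0 : ℝ) 1 from ⟨hx.1 i, hx.2 i⟩)]

theorem IsSmoothFamily.familyExt_eq_fst {p : M → ℂ} {c : Chain k (U → M)}
    (hc : IsSmoothFamily E p c) {s : Cube k → U → M} (hs : s ∈ c.support) (t : U) :
    EqOn (fun q => p (familyExt s t q)) Prod.fst ((U : Set ℂ) ×ˢ Icc 0 1) := by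
  rintro ⟨u, x⟩ ⟨hu, hx⟩
  simp only []
  rw [familyExt_of_mem s t ⟨u, hu⟩]
  exact (hc s hs).2 ⟨u, hu⟩ _

/-- The family lies over `U`, so `dt` pulls back to the projection to the base. -/
theorem IsSmoothFamily.fderivWithin_familyExt {p : M → ℂ} {c : Chain k (U → M)}
    (hc : IsSmoothFamily E p c) {s : Cube k → U → M} (hs : s ∈ c.support) (t : U)
    {q : ℂ × (Fin k → ℝ)} (hq : q ∈ (U : Set ℂ) ×ˢ Icc (0 : Fin k → ℝ) 1) :
    fderivWithin ℝ (fun q => p (familyExt s t q)) ((U : Set ℂ) ×ˢ Icc 0 1) q =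
      ContinuousLinearMap.fst ℝ ℂ (Fin k → ℝ) := by
  rw [fderivWithin_congr (hc.familyExt_eq_fst hs t) (hc.familyExt_eq_fst hs t hq)]
  exact fderivWithin_fst (uniqueDiffOn_family U k q hq)

/-- The integral of a form over the members of a family of cubes. -/
theorem DiffForm.cubeIntegral_member [IsManifold 𝓘(ℝ, E) ∞ M] (θ : DiffForm E M k) {s : Cube k → U → M} {t : U}
    (hs : ContMDiffOn 𝓘(ℝ, ℂ × (Fin k → ℝ)) 𝓘(ℝ, E) ∞ (familyExt s t) ((U : Set ℂ) ×ˢ Icc 0 1))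
    (u : U) : θ.cubeIntegral (fun y => s y u) =
      ∫ x in Icc (0 : Fin k → ℝ) 1,
        θ.pull (familyExt s t) ((U : Set ℂ) ×ˢ Icc 0 1) (u, x) fun i => (0, Pi.single i 1) := by
  refine setIntegral_congr_fun measurableSet_Icc fun x hx => ?_
  have hm : MapsTo (fun x : Fin k → ℝ => ((u : ℂ), x)) (Icc 0 1) ((U : Set ℂ) ×ˢ Icc 0 1) :=
    fun x hx => ⟨u.2, hx⟩
  have h := θ.pull_comp (hs _ (hm hx)) (uniqueDiffOn_box k x hx)
    (hasFDerivAt_prodMk_right (𝕜 := ℝ) (u : ℂ) x).hasFDerivWithinAt hm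
  have h0 : cubeExt (fun y => s y u) = fun x => familyExt s t (u, x) :=
    funext fun x => (familyExt_of_mem s t u x).symm
  simp only [θ.pullbackCube_eq, h0, h]
  rfl

/-- The integral over a cube of the contraction of a form with the vector `v` of the base. -/
def DiffForm.flux (θ : DiffForm E M (k + 1)) (t : U) (v : ℂ) (s : Cube k → U → M) : ℂ :=
  ∫ y in Icc (0 : Fin k → ℝ) 1,
    θ.pull (familyExt s t) ((U : Set ℂ) ×ˢ Icc 0 1) ((t : ℂ), y) (transverseFrame k v)

theorem IsDegenerate.familyExt_add_smul {X : Type*} {s : Cube k → U → X} (hs : IsDegenerate s)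
    (t : U) : ∃ j : Fin k, ∀ (q : ℂ × (Fin k → ℝ)) (r : ℝ),
      familyExt s t (q + r • ((0, Pi.single j 1) : ℂ × (Fin k → ℝ))) = familyExt s t q := by
  obtain ⟨j, hj⟩ := hs.cubeExt_add_smul
  refine ⟨j, fun q r => ?_⟩
  have h : q + r • ((0, Pi.single j 1) : ℂ × (Fin k → ℝ)) = (q.1, q.2 + r • Pi.single j 1) := by
    ext <;> simp
  rw [h]
  simp only [familyExt, hj]

theorem DiffForm.flux_of_isDegenerate (θ : DiffForm E M (k + 1)) (t : U) (v : ℂ)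
    (s : Cube k → U → M) (hs : IsDegenerate s) : θ.flux t v s = 0 := by
  obtain ⟨j, hj⟩ := hs.familyExt_add_smul t
  refine integral_eq_zero_of_ae ?_
  filter_upwards [ae_mem_interior_box k] with x hx
  -- The slot is `j.succ`, because slot `0` of the frame holds the direction `v` of the base.
  refine θ.pull_eq_zero_of_invariant (prod_mem_nhds (U.isOpen.mem_nhds t.2)
    (mem_interior_iff_mem_nhds.1 hx)) j.succ fun r => ?_
  simp only [transverseFrame, Fin.cons_succ]
  exact hj _ r

/-- The inclusion of the face, extended by the identity of the base, maps the transverse frame to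
the one without its `i.succ`-th vector. These are the integrals in the boundary terms of Cartan's
formula. -/
theorem DiffForm.flux_face [IsManifold 𝓘(ℝ, E) ∞ M] (θ : DiffForm E M (k + 1)) {t : U}
    {s : Cube (k + 1) → U → M}
    (hs : ContMDiffOn 𝓘(ℝ, ℂ × (Fin (k + 1) → ℝ)) 𝓘(ℝ, E) ∞ (familyExt s t)
      ((U : Set ℂ) ×ˢ Icc 0 1)) (v : ℂ) (i : Fin (k + 1)) (a : unitInterval) :
    θ.flux t v (face i a s) = ∫ y in Icc (0 : Fin k → ℝ) 1,
      θ.pull (familyExt s t) ((U : Set ℂ) ×ˢ Icc 0 1) ((t : ℂ), i.insertNth (a : ℝ) y)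
        (i.succ.removeNth (transverseFrame (k + 1) v)) := by
  refine setIntegral_congr_fun measurableSet_Icc fun y hy => ?_
  have hm : MapsTo (fun q : ℂ × (Fin k → ℝ) =>
      ((q.1, i.insertNth (a : ℝ) q.2) : ℂ × (Fin (k + 1) → ℝ))) ((U : Set ℂ) ×ˢ Icc 0 1)
      ((U : Set ℂ) ×ˢ Icc 0 1) := fun q hq => ⟨hq.1, mapsTo_insertNth_box i a hq.2⟩
  have hp : ((t : ℂ), y) ∈ (U : Set ℂ) ×ˢ Icc (0 : Fin k → ℝ) 1 := ⟨t.2, hy⟩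
  have hd : HasFDerivAt (fun q : ℂ × (Fin k → ℝ) =>
      ((q.1, i.insertNth (a : ℝ) q.2) : ℂ × (Fin (k + 1) → ℝ)))
      ((ContinuousLinearMap.fst ℝ ℂ (Fin k → ℝ)).prod
        ((insertZero i).comp (ContinuousLinearMap.snd ℝ ℂ (Fin k → ℝ)))) ((t : ℂ), y) := by
    have h2 : HasFDerivAt (fun q : ℂ × (Fin k → ℝ) => q.2) _ ((t : ℂ), y) :=
      hasFDerivAt_snd (𝕜 := ℝ)
    have h3 : HasFDerivAt (fun q : ℂ × (Fin k → ℝ) =>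
        (i.insertNth (a : ℝ) q.2 : Fin (k + 1) → ℝ)) _ ((t : ℂ), y) :=
      HasFDerivAt.comp (g := fun y : Fin k → ℝ => (i.insertNth (a : ℝ) y : Fin (k + 1) → ℝ))
        ((t : ℂ), y) (hasFDerivAt_insertNth i (a : ℝ) y) h2
    exact hasFDerivAt_fst.prodMk h3
  have h := θ.pull_comp (h := fun q : ℂ × (Fin k → ℝ) =>
    ((q.1, i.insertNth (a : ℝ) q.2) : ℂ × (Fin (k + 1) → ℝ))) (hs _ (hm hp))
    (uniqueDiffOn_family U k _ hp) hd.hasFDerivWithinAt hm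
  have h0 : familyExt (face i a s) t =
      fun q => familyExt s t (q.1, i.insertNth (a : ℝ) q.2) := by
    ext q
    simp only [familyExt, cubeExt_face]
  simp only [h0, h, ContinuousAlternatingMap.compContinuousLinearMap_apply]
  congr 1
  ext1 j
  refine Fin.cases ?_ (fun j => ?_) j
  · simp [transverseFrame, Fin.removeNth]
  · simp [transverseFrame, Fin.removeNth, insertZero_single]

/-- The integral over the members of a family of chains, as a function on the base. -/
def DiffForm.familyIntegral (θ : DiffForm E M k) (c : Chain k (U → M)) (t : U) (u : ℂ) : ℂ :=
  Finsupp.linearCombination ℤ (fun s => ∫ x in Icc (0 : Fin k → ℝ) 1,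
    θ.pull (familyExt s t) ((U : Set ℂ) ×ˢ Icc 0 1) (u, x) fun i => (0, Pi.single i 1)) c

theorem DiffForm.integral_member [IsManifold 𝓘(ℝ, E) ∞ M] (θ : DiffForm E M k) {p : M → ℂ}
    {c : Chain k (U → M)} (hc : IsSmoothFamily E p c) (t u : U) :
    θ.integral (member c u) = θ.familyIntegral c t u := by
  rw [θ.integral_eq, member, linearCombination_push]
  exact linearCombination_congr fun s hs =>
    θ.cubeIntegral_member (hc.contMDiffOn_familyExt hs t) u

theorem DiffForm.differentiableAt_familyIntegral [IsManifold 𝓘(ℝ, E) ∞ M] (θ : DiffForm E M k)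
    {p : M → ℂ} {c : Chain k (U → M)} (hc : IsSmoothFamily E p c) (t : U) :
    DifferentiableAt ℝ (θ.familyIntegral c t) t := by
  unfold DiffForm.familyIntegral
  simp only [Finsupp.linearCombination_apply, Finsupp.sum, zsmul_eq_mul]
  refine DifferentiableAt.fun_sum fun s hs => DifferentiableAt.const_mul ?_ _
  exact differentiableAt_integral_family (fun v => (θ.contDiffOn_pull_apply
    (hc.contMDiffOn_familyExt hs t) (uniqueDiffOn_family U k) v).of_le (by simp)) t.2

theorem DiffForm.fderiv_familyIntegral_eq [IsManifold 𝓘(ℝ, E) ∞ M] (θ : DiffForm E M k)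
    {p : M → ℂ} {c : Chain k (U → M)} (hc : IsSmoothFamily E p c) (t : U) (v : ℂ) :
    fderiv ℝ (θ.familyIntegral c t) t v =
      Finsupp.linearCombination ℤ (fun s => fderiv ℝ (fun u => ∫ x in Icc (0 : Fin k → ℝ) 1,
        θ.pull (familyExt s t) ((U : Set ℂ) ×ˢ Icc 0 1) (u, x) fun i => (0, Pi.single i 1)) t v)
        c := by
  have hd : ∀ s ∈ c.support, DifferentiableAt ℝ (fun u => ∫ x in Icc (0 : Fin k → ℝ) 1,
      θ.pull (familyExt s t) ((U : Set ℂ) ×ˢ Icc 0 1) (u, x) fun i => (0, Pi.single i 1)) t :=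
    fun s hs => differentiableAt_integral_family (fun v => (θ.contDiffOn_pull_apply
      (hc.contMDiffOn_familyExt hs t) (uniqueDiffOn_family U k) v).of_le (by simp)) t.2
  unfold DiffForm.familyIntegral
  simp only [Finsupp.linearCombination_apply, Finsupp.sum, zsmul_eq_mul]
  rw [fderiv_fun_sum fun s hs => (hd s hs).const_mul _, sum_apply]
  refine Finset.sum_congr rfl fun s hs => ?_
  rw [fderiv_const_mul (hd s hs)]
  rfl

/-- The integral of the exterior derivative of a form over a family of cubes, contracted with the
vector `v` of the base. -/
def DiffForm.extDerivFlux (θ : DiffForm E M k) (t : U) (v : ℂ) (s : Cube k → U → M) : ℂ :=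
  ∫ x in Icc (0 : Fin k → ℝ) 1, extDerivWithin
    (θ.pull (familyExt s t) ((U : Set ℂ) ×ˢ Icc 0 1)) ((U : Set ℂ) ×ˢ Icc 0 1) ((t : ℂ), x)
    (transverseFrame k v)

theorem DiffForm.fderiv_familyIntegral_zero [IsManifold 𝓘(ℝ, E) ∞ M] (θ : DiffForm E M 0)
    {p : M → ℂ} {c : Chain 0 (U → M)} (hc : IsSmoothFamily E p c) (t : U) (v : ℂ) :
    fderiv ℝ (θ.familyIntegral c t) t v =
      Finsupp.linearCombination ℤ (θ.extDerivFlux t v) c := by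
  rw [θ.fderiv_familyIntegral_eq hc]
  refine linearCombination_congr fun s hs => ?_
  have hs' := hc.contMDiffOn_familyExt hs t
  rw [fderiv_integral_family (θ.differentiableOn_pull hs' (uniqueDiffOn_family U 0))
    (fun v => (θ.contDiffOn_pull_apply hs' (uniqueDiffOn_family U 0) v).of_le (by simp)) t.2]
  simp [DiffForm.extDerivFlux]

/-- Cartan's formula summed over the cubes; its face terms carry the signs of `boundary`. -/
theorem DiffForm.fderiv_familyIntegral_succ [IsManifold 𝓘(ℝ, E) ∞ M] (θ : DiffForm E M (k + 1))
    {p : M → ℂ} {c : Chain (k + 1) (U → M)} (hc : IsSmoothFamily E p c) (t : U) (v : ℂ) :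
    fderiv ℝ (θ.familyIntegral c t) t v =
      Finsupp.linearCombination ℤ (θ.extDerivFlux t v) c +
        Finsupp.linearCombination ℤ (θ.flux t v) (boundary c) := by
  rw [θ.fderiv_familyIntegral_eq hc, linearCombination_boundary, ← linearCombination_fun_add]
  refine linearCombination_congr fun s hs => ?_
  have hs' := hc.contMDiffOn_familyExt hs t
  rw [fderiv_integral_family_succ (θ.differentiableOn_pull hs' (uniqueDiffOn_family U (k + 1)))
    (fun v => (θ.contDiffOn_pull_apply hs' (uniqueDiffOn_family U (k + 1)) v).of_le (by simp)) t.2]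
  congr 1
  refine Finset.sum_congr rfl fun i _ => ?_
  rw [θ.flux_face hs' v i 1, θ.flux_face hs' v i 0]
  rfl

/-- In positive degree the boundary is degenerate and has no flux; in degree zero there are no
faces. -/
theorem DiffForm.fderiv_familyIntegral_of_isCycle [IsManifold 𝓘(ℝ, E) ∞ M] (θ : DiffForm E M k)
    {p : M → ℂ} {c : Chain k (U → M)} (hc : IsSmoothFamily E p c) (hcyc : IsCycle c) (t : U)
    (v : ℂ) : fderiv ℝ (θ.familyIntegral c t) t v =
      Finsupp.linearCombination ℤ (θ.extDerivFlux t v) c := by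
  cases k with
  | zero => exact θ.fderiv_familyIntegral_zero hc t v
  | succ k =>
    rw [θ.fderiv_familyIntegral_succ hc,
      linearCombination_eq_of_chainEq (θ.flux_of_isDegenerate t v) (show ChainEq _ 0 from hcyc),
      map_zero, add_zero]

/-- Only the first vector of the frame has a component along the base, so a single term of `dt ∧ A`
survives. -/
theorem alternatizeUncurryFin_fst_transverseFrame
    (A : (ℂ × (Fin k → ℝ)) [⋀^Fin k]→L[ℝ] ℂ) (v : ℂ) :
    ContinuousAlternatingMap.alternatizeUncurryFin
      ((ContinuousLinearMap.fst ℝ ℂ (Fin k → ℝ)).smulRight A) (transverseFrame k v) =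
      v * A fun i => (0, Pi.single i 1) := by
  rw [ContinuousAlternatingMap.alternatizeUncurryFin_apply, Fin.sum_univ_succ]
  have : Fin.removeNth 0 (transverseFrame k v) = fun i => (0, Pi.single i 1) := by
    ext1 i
    simp [Fin.removeNth, transverseFrame]
  simp [transverseFrame] at this ⊢

theorem IsExtDerivDivBy.extDerivFlux_eq [IsManifold 𝓘(ℝ, E) ∞ M] {π : M → ℂ}
    {w η : DiffForm E M k} (h : IsExtDerivDivBy π w η) (hπ : ContMDiff 𝓘(ℝ, E) 𝓘(ℝ, ℂ) ∞ π)
    {c : Chain k (U → M)} (hc : IsSmoothFamily E π c) (t : U) (v : ℂ) :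
    Finsupp.linearCombination ℤ (w.extDerivFlux t v) c = v * η.integral (member c t) := by
  rw [η.integral_member hc t t, DiffForm.familyIntegral, ← linearCombination_fun_const_mul]
  refine linearCombination_congr fun s hs => ?_
  rw [DiffForm.extDerivFlux, ← integral_const_mul]
  refine setIntegral_congr_fun measurableSet_Icc fun x hx => ?_
  have hp : ((t : ℂ), x) ∈ (U : Set ℂ) ×ˢ Icc (0 : Fin k → ℝ) 1 := ⟨t.2, hx⟩
  rw [h.extDerivWithin_pull hπ (hc.contMDiffOn_familyExt hs t) (uniqueDiffOn_family U k)
    (subset_closure_interior_family U k) hp, hc.fderivWithin_familyExt hs t hp,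
    alternatizeUncurryFin_fst_transverseFrame]

/-- Insert `g^*w = dα + dt ∧ β` on the family of cycles. Contraction with `v` turns `dt ∧ β` into `v
β`, and the contracted `dα` integrates to the derivative of `∫ α` because a cycle has no boundary
term. -/
theorem IsRestrictionDivBy.flux_eq [IsManifold 𝓘(ℝ, E) ∞ M] {π : M → ℂ}
    {F : Type*} [NormedAddCommGroup F] [NormedSpace ℂ F]
    {Z : Type*} [TopologicalSpace Z] [ChartedSpace F Z] [IsManifold 𝓘(ℝ, F) ∞ Z] {g : Z → M}
    {w : DiffForm E M (k + 1)} {α β : DiffForm F Z k} (h : IsRestrictionDivBy π g w α β)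
    (hπ : ContMDiff 𝓘(ℝ, E) 𝓘(ℝ, ℂ) ∞ π) (hg : ContMDiff 𝓘(ℝ, F) 𝓘(ℝ, E) ∞ g)
    {c : Chain k (U → Z)} (hc : IsSmoothFamily F (π ∘ g) c) (hcyc : IsCycle c) (t : U) (v : ℂ) :
    Finsupp.linearCombination ℤ (w.flux t v) (push (fun f => g ∘ f) c) =
      fderiv ℝ (α.familyIntegral c t) t v + v * β.integral (member c t) := by
  rw [linearCombination_push, α.fderiv_familyIntegral_of_isCycle hc hcyc,
    β.integral_member hc t t, DiffForm.familyIntegral, ← linearCombination_fun_const_mul,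
    ← linearCombination_fun_add]
  refine linearCombination_congr fun s hs => ?_
  have hs' := hc.contMDiffOn_familyExt hs t
  have hQ := uniqueDiffOn_family U k
  have hslice : MapsTo (fun x : Fin k → ℝ => ((t : ℂ), x)) (Icc 0 1)
      ((U : Set ℂ) ×ˢ Icc 0 1) := fun x hx => ⟨t.2, hx⟩
  have hpt : ∀ x ∈ Icc (0 : Fin k → ℝ) 1,
      extDerivWithin (α.pull (familyExt s t) ((U : Set ℂ) ×ˢ Icc 0 1)) ((U : Set ℂ) ×ˢ Icc 0 1)
        ((t : ℂ), x) (transverseFrame k v) =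
      w.pull (fun q => g (familyExt s t q)) ((U : Set ℂ) ×ˢ Icc 0 1) ((t : ℂ), x)
        (transverseFrame k v) - v * β.pull (familyExt s t) ((U : Set ℂ) ×ˢ Icc 0 1) ((t : ℂ), x)
          fun i => (0, Pi.single i 1) := by
    intro x hx
    have h1 := h.pull_eq hπ hg hs' hQ (subset_closure_interior_family U k) (hslice hx)
    have h2 := hc.fderivWithin_familyExt hs t (hslice hx)
    simp only [Function.comp] at h2
    rw [h1, h2, ContinuousAlternatingMap.add_apply, alternatizeUncurryFin_fst_transverseFrame]
    ring
  have hw : ContinuousOn (fun x => w.pull (fun q => g (familyExt s t q)) ((U : Set ℂ) ×ˢ Icc 0 1)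
      ((t : ℂ), x) (transverseFrame k v)) (Icc 0 1) :=
    (w.contDiffOn_pull_apply (hg.comp_contMDiffOn hs') hQ _).continuousOn.comp (by fun_prop) hslice
  have hb : ContinuousOn (fun x => v * β.pull (familyExt s t) ((U : Set ℂ) ×ˢ Icc 0 1)
      ((t : ℂ), x) fun i => (0, Pi.single i 1)) (Icc 0 1) :=
    continuousOn_const.mul
      ((β.contDiffOn_pull_apply hs' hQ _).continuousOn.comp (by fun_prop) hslice)
  rw [DiffForm.extDerivFlux, setIntegral_congr_fun measurableSet_Icc hpt,
    integral_sub hw.integrableOn_Icc hb.integrableOn_Icc, integral_const_mul, sub_add_cancel]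
  rfl

end CubeIntegrals

/-! ### Integrals of homologous chains -/

section RelativeHomology

open MeasureTheory

variable {E : Type*} [NormedAddCommGroup E] [NormedSpace ℂ E]
variable {M : Type*} [TopologicalSpace M] [ChartedSpace E M]
variable {k : ℕ}

theorem DiffForm.integral_eq_of_relHomologous [IsManifold 𝓘(ℝ, E) ∞ M]
    {θ : DiffForm E M k} {A B : Set M}
    {c c' : Chain k M} (hA : ∀ τ : Cube (k + 1) → M, IsSmoothCube E τ → (∀ x, τ x ∈ A) →
      ∀ x ∈ Icc (0 : Fin (k + 1) → ℝ) 1,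
        extDerivWithin (θ.pull (cubeExt τ) (Icc 0 1)) (Icc 0 1) x (fun i => Pi.single i 1) = 0)
    (hB : ∀ s : Cube k → M, IsSmoothCube E s → (∀ x, s x ∈ B) → θ.cubeIntegral s = 0)
    (h : RelHomologous E A B c c') : θ.integral c = θ.integral c' := by
  obtain ⟨τ, ε, hτ, hε, heq⟩ := h
  have h1 := linearCombination_eq_of_chainEq θ.cubeIntegral_of_isDegenerate heq
  rw [map_sub, map_add, linearCombination_boundary] at h1
  rw [θ.integral_eq, θ.integral_eq, ← sub_eq_zero, h1]
  have h2 : Finsupp.linearCombination ℤ θ.cubeIntegral ε = 0 := by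
    rw [Finsupp.linearCombination_apply]
    exact Finset.sum_eq_zero fun s hs => by simp [hB s (hε s hs).1 (hε s hs).2]
  rw [h2, add_zero, Finsupp.linearCombination_apply]
  refine Finset.sum_eq_zero fun s hs => ?_
  simp only []
  rw [θ.sum_cubeIntegral_face (hτ s hs).1,
    setIntegral_congr_fun measurableSet_Icc (hA s (hτ s hs).1 (hτ s hs).2)]
  simp

/-- `B` comes from the product rule. `C` is chosen so that `B + C` is symmetric whenever the
derivative of `a` is, as for `a = dp`; alternatizing `C` twice gives `a ∧ dθ`. -/
theorem exists_hasFDerivAt_smulRight {V F : Type*} [NormedAddCommGroup V] [NormedSpace ℝ V]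
    [NormedAddCommGroup F] [NormedSpace ℝ F] [NormedSpace ℂ F] [IsScalarTower ℝ ℂ F]
    {a : V → V →L[ℝ] ℂ} {θ : V → F} {y : V} (ha : DifferentiableAt ℝ a y)
    (hθ : DifferentiableAt ℝ θ y) :
    ∃ B C : V →L[ℝ] V →L[ℝ] F, HasFDerivAt (fun u => (a u).smulRight (θ u)) B y ∧
      (∀ v u, B v u = fderiv ℝ a y v u • θ y + a y u • fderiv ℝ θ y v) ∧
      ∀ v u, C v u = a y v • fderiv ℝ θ y u := by
  let S : F →L[ℝ] ℂ →L[ℝ] F := (ContinuousLinearMap.lsmul ℝ ℂ).flip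
  have hS : HasFDerivAt (fun u => S (θ u)) (S ∘L fderiv ℝ θ y) y :=
    S.hasFDerivAt.comp y hθ.hasFDerivAt
  refine ⟨_, (((ContinuousLinearMap.compL ℝ V ℂ F).flip (a y)) ∘L (S ∘L fderiv ℝ θ y)).flip,
    hS.clm_comp ha.hasFDerivAt, fun v u => ?_, fun v u => ?_⟩
  · simp [S]
  · simp [S]

/-- If `dw = dp ∧ η`, then `dp ∧ dη = 0`. -/
theorem wedge_extDeriv_eq_zero {w η : E → E [⋀^Fin k]→L[ℝ] ℂ} {p : E → ℂ}
    {y : E} (hw : ContDiffAt ℝ ∞ w y) (hη : ContDiffAt ℝ ∞ η y) (hp : ContDiffAt ℝ ∞ p y)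
    (h : ∀ᶠ u in 𝓝 y, extDeriv w u = wedge (fderiv ℝ p u) (η u)) :
    wedge (fderiv ℝ p y) (extDeriv η y) = 0 := by
  have h2 : minSmoothness ℝ 2 ≤ (∞ : WithTop ℕ∞) := by
    rw [minSmoothness_of_isRCLikeNormedField]; exact WithTop.coe_le_coe.2 le_top
  have hdd := extDeriv_extDeriv_apply hw h2
  rw [Filter.EventuallyEq.extDeriv_eq h] at hdd
  have hp' : DifferentiableAt ℝ (fderiv ℝ p) y :=
    (hp.fderiv_right (m := ∞) (by simp)).differentiableAt (by simp)
  obtain ⟨B, C, hB, hBapp, hC⟩ := exists_hasFDerivAt_smulRight hp' (hη.differentiableAt (by simp))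
  have hB' : fderiv ℝ (fun u => wedge (fderiv ℝ p u) (η u)) y =
      (ContinuousAlternatingMap.alternatizeUncurryFinCLM ℝ E ℂ) ∘L B :=
    ((ContinuousAlternatingMap.alternatizeUncurryFinCLM ℝ E ℂ).hasFDerivAt.comp y hB).fderiv
  rw [extDeriv, hB'] at hdd
  -- The double alternatization of the symmetric map `B + C` vanishes. The part from `B` is `ddw =
  -- 0`, so the part from `C`, which is `dp ∧ dη`, vanishes too.
  have hsymm := ContinuousAlternatingMap.alternatizeUncurryFin_alternatizeUncurryFinCLM_comp_of_symmetric
    (f := B + C) fun u v => by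
      rw [add_apply, add_apply, add_apply, add_apply, hBapp, hBapp, hC, hC,
        (hp.isSymmSndFDerivAt h2).eq u v]
      abel
  rw [ContinuousLinearMap.comp_add, ContinuousAlternatingMap.alternatizeUncurryFin_add, hdd,
    zero_add] at hsymm
  rw [← hsymm]
  unfold wedge extDeriv
  congr 1
  ext1 u
  ext w
  simp [ContinuousAlternatingMap.alternatizeUncurryFin_apply, hC, Finset.mul_sum, mul_left_comm]

theorem exists_fderiv_chart_symm_eq_one [IsManifold 𝓘(ℂ, E) ∞ M] {π : M → ℂ}
    (hπ : ContMDiff 𝓘(ℂ, E) 𝓘(ℂ, ℂ) ∞ π) {x : M}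
    (hx : Function.Surjective (mfderiv 𝓘(ℂ, E) 𝓘(ℂ, ℂ) π x)) :
    ∃ v, fderiv ℝ (fun u => π ((chartAt E x).symm u)) (chartAt E x x) v = 1 := by
  have hd : MDifferentiableAt 𝓘(ℂ, E) 𝓘(ℂ, ℂ) π x := (hπ x).mdifferentiableAt (by simp)
  obtain ⟨v, hv⟩ := hx (1 : ℂ)
  refine ⟨v, ?_⟩
  have hv' : (fderivWithin ℂ (writtenInExtChartAt 𝓘(ℂ, E) 𝓘(ℂ, ℂ) x π) (range 𝓘(ℂ, E))
      (extChartAt 𝓘(ℂ, E) x x) : E →L[ℂ] ℂ) v = (1 : ℂ) :=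
    (congrArg (fun A : E →L[ℂ] ℂ => A v) hd.mfderiv).symm.trans hv
  have hd' : DifferentiableAt ℂ (fun u => π ((chartAt E x).symm u)) (chartAt E x x) := by
    have := (mdifferentiableAt_iff _ _).1 hd |>.2
    simpa [writtenInExtChartAt, Function.comp_def, chartAt_self_eq,
      differentiableWithinAt_univ] using this
  rw [hd'.fderiv_restrictScalars ℝ]
  simpa [writtenInExtChartAt, Function.comp_def, chartAt_self_eq] using hv'

/-- The forms `w` and `η = dw/dt` are closed on the fibres of `t`. -/
theorem IsExtDerivDivBy.extDerivWithin_pull_eq_zero [IsManifold 𝓘(ℝ, E) ∞ M]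
    {π : M → ℂ} {w η : DiffForm E M k}
    (h : IsExtDerivDivBy π w η) (hπ : ContMDiff 𝓘(ℝ, E) 𝓘(ℝ, ℂ) ∞ π) {t : ℂ}
    {τ : Cube (k + 1) → M} (hτ : IsSmoothCube E τ) (hτt : ∀ x, τ x ∈ fibre π t)
    {x : Fin (k + 1) → ℝ} (hx : x ∈ Icc (0 : Fin (k + 1) → ℝ) 1) :
    extDerivWithin (w.pull (cubeExt τ) (Icc 0 1)) (Icc 0 1) x = 0 := by
  rw [h.extDerivWithin_pull hπ hτ (uniqueDiffOn_box _) (closure_interior_box _).ge hx]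
  -- The function `t` is constant on the cube, so `dt` pulls back to zero.
  have h0 : (fun q => π (cubeExt τ q)) = fun _ => t := funext fun q => hτt _
  ext v
  simp [h0, ContinuousAlternatingMap.alternatizeUncurryFin_apply]

/-- Evaluate `dt ∧ dη = 0` on a vector with `dt = 1` followed by vectors tangent to the cube, on
which `dt = 0`. Only the value of `dη` on the tangent vectors remains. -/
theorem IsExtDerivDivBy.extDerivWithin_pull_quotient_eq_zero [IsManifold 𝓘(ℝ, E) ∞ M]
    {π : M → ℂ} {w η : DiffForm E M k}
    (h : IsExtDerivDivBy π w η) (hπ : ContMDiff 𝓘(ℝ, E) 𝓘(ℝ, ℂ) ∞ π)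
    (hsurj : ∀ x, ∃ v, fderiv ℝ (fun u => π ((chartAt E x).symm u)) (chartAt E x x) v = 1) {t : ℂ}
    {τ : Cube (k + 1) → M} (hτ : IsSmoothCube E τ) (hτt : ∀ x, τ x ∈ fibre π t)
    {x : Fin (k + 1) → ℝ} (hx : x ∈ Icc (0 : Fin (k + 1) → ℝ) 1) :
    extDerivWithin (η.pull (cubeExt τ) (Icc 0 1)) (Icc 0 1) x = 0 := by
  set φ := chartAt E (cubeExt τ x) with hφdef
  have hφ : φ ∈ atlas E M := chart_mem_atlas E (cubeExt τ x)
  have hs : cubeExt τ x ∈ φ.source := mem_chart_source E (cubeExt τ x)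
  have hy := φ.map_source hs
  have hyn := φ.open_target.mem_nhds hy
  have hsy := (contMDiffOn_symm_of_mem_maximalAtlas (I := 𝓘(ℝ, E)) (n := ∞)
    (IsManifold.subset_maximalAtlas hφ)).contMDiffAt hyn
  have hπφ : ContDiffAt ℝ ∞ (fun u => π (φ.symm u)) (φ (cubeExt τ x)) :=
    (hπ.contMDiffAt.comp _ hsy).contDiffAt
  have hw := wedge_extDeriv_eq_zero ((w.smooth φ hφ).contDiffAt hyn)
    ((η.smooth φ hφ).contDiffAt hyn) hπφ
    (Filter.mem_of_superset hyn fun u hu => h φ hφ u hu)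
  obtain ⟨v₀, hv₀⟩ := hsurj (cubeExt τ x)
  rw [← hφdef] at hv₀
  have hch := fderivWithin_comp_chart (h := π) (hτ x hx) (uniqueDiffOn_box _ x hx) hx hφ hs
    (hπφ.differentiableAt (by simp))
  have h0 : (fun q => π (cubeExt τ q)) = fun _ => t := funext fun q => hτt _
  rw [h0, fderivWithin_fun_const] at hch
  rw [η.extDerivWithin_pull hτ (uniqueDiffOn_box _) (closure_interior_box _).ge hx hφ hs]
  ext v
  set L := fderivWithin ℝ (fun q => φ (cubeExt τ q)) (Icc 0 1) x with hL
  have hv := congrArg (fun A => A (Fin.cons v₀ fun i => L (v i))) hw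
  simp only [wedge, ContinuousAlternatingMap.alternatizeUncurryFin_apply, Fin.sum_univ_succ] at hv
  have hz : ∀ i, fderiv ℝ (fun u => π (φ.symm u)) (φ (cubeExt τ x)) (L (v i)) = 0 := fun i =>
    (congrArg (fun A => A (v i)) hch).symm
  simpa [hz, hv₀, Function.comp_def] using hv

end RelativeHomology

/-! ### Chains in sets of small dimension -/

section Dimension

open MeasureTheory

variable {E : Type*} [NormedAddCommGroup E] [NormedSpace ℂ E]
variable {M : Type*} [TopologicalSpace M] [ChartedSpace E M]
variable {k : ℕ}

/-- A smooth cube is locally Lipschitz in charts, hence does not raise Hausdorff dimension, and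
countable unions take the supremum. -/
theorem dimH_chart_image_le [IsManifold 𝓘(ℝ, E) ∞ M]
    {ι : Type*} [Countable ι] {s : ι → Cube k → M} {φ : OpenPartialHomeomorph M E}
    (hφ : φ ∈ atlas E M) (hs : ∀ l, IsSmoothCube E (s l)) :
    dimH (φ '' ((⋃ l, range (s l)) ∩ φ.source)) ≤ k := by
  rw [iUnion_inter, image_iUnion, dimH_iUnion]
  refine iSup_le fun l => ?_
  set Q := {x ∈ Icc (0 : Fin k → ℝ) 1 | cubeExt (s l) x ∈ φ.source} with hQ
  have hsub : φ '' (range (s l) ∩ φ.source) ⊆ (fun x => φ (cubeExt (s l) x)) '' Q := by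
    rintro _ ⟨_, ⟨⟨x, rfl⟩, hx⟩, rfl⟩
    have he : cubeExt (s l) (fun i => (x i : ℝ)) = s l x := by simp [cubeExt, projIcc_val]
    exact ⟨fun i => (x i : ℝ), ⟨⟨fun i => (x i).2.1, fun i => (x i).2.2⟩, by rwa [he]⟩,
      by simp only [he]⟩
  refine (dimH_mono hsub).trans ((dimH_image_le_of_locally_lipschitzOn ?_).trans ?_)
  · rintro x ⟨hx, hxφ⟩
    have h1 := contDiffWithinAt_chart_comp (hs l x hx) hφ hxφ
    obtain ⟨K, u, hu, hL⟩ := (h1.of_le (by simp)).exists_lipschitzOnWith (convex_Icc 0 1)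
    exact ⟨K, u, nhdsWithin_mono _ (fun y hy => hy.1) hu, hL⟩
  · exact (dimH_mono (subset_univ Q)).trans (Real.dimH_univ_pi_fin k).le

/-- The integral of a form over a smooth cube whose image has smaller dimension vanishes. -/
theorem DiffForm.cubeIntegral_eq_zero_of_dimH_lt [IsManifold 𝓘(ℝ, E) ∞ M]
    [FiniteDimensional ℂ E] (θ : DiffForm E M k)
    {Y : Set M} (hY : ∀ φ ∈ atlas E M, dimH (φ '' (Y ∩ φ.source)) < k) {s : Cube k → M}
    (hs : IsSmoothCube E s) (hsY : ∀ x, s x ∈ Y) : θ.cubeIntegral s = 0 := by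
  refine integral_eq_zero_of_ae ?_
  filter_upwards [ae_mem_interior_box k] with x hx
  have hxn := mem_interior_iff_mem_nhds.1 hx
  have hxI := interior_subset hx
  set φ := chartAt E (cubeExt s x) with hφdef
  have hφ : φ ∈ atlas E M := chart_mem_atlas E (cubeExt s x)
  have hsx : cubeExt s x ∈ φ.source := mem_chart_source E (cubeExt s x)
  set L := fderivWithin ℝ (fun q => φ (cubeExt s q)) (Icc 0 1) x with hL
  have hval : θ.pullbackCube s x = θ.rep φ (φ (cubeExt s x)) fun i => L (Pi.single i 1) := rfl
  rw [hval]
  -- An alternating form vanishes on dependent vectors. If the partial derivatives were independent,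
  -- `L` would have a left inverse `P`, and `P ∘ φ ∘ s` would be a local diffeomorphism of `ℝᵏ`. Its
  -- image would then contain an open set, of dimension `k`, although it lies in the image under the
  -- Lipschitz map `P` of a set of smaller dimension.
  refine (θ.rep φ (φ (cubeExt s x))).toAlternatingMap.map_linearDependent _ fun hli => ?_
  have hker : LinearMap.ker (L : (Fin k → ℝ) →ₗ[ℝ] E) = ⊥ := by
    rw [LinearMap.ker_eq_bot']
    intro c hc
    have h1 : ∑ i, c i • L (Pi.single i 1) = 0 := by
      rw [← hc]
      conv_rhs => rw [pi_eq_sum_univ' c]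
      simp
    exact funext (Fintype.linearIndependent_iff.1 hli c h1)
  obtain ⟨P, hP⟩ := LinearMap.exists_leftInverse_of_injective _ hker
  have : FiniteDimensional ℝ E := FiniteDimensional.complexToReal E
  set P' : E →L[ℝ] (Fin k → ℝ) := LinearMap.toContinuousLinearMap P with hP'
  have hPL : P'.comp L = ContinuousLinearMap.id ℝ _ := by
    ext1 v
    exact congrArg (fun A => A v) hP
  have hsm : ContDiffAt ℝ ∞ (fun q => φ (cubeExt s q)) x :=
    (contDiffWithinAt_chart_comp (hs x hxI) hφ hsx).contDiffAt hxn
  have hst : HasStrictFDerivAt (fun q => P' (φ (cubeExt s q))) (ContinuousLinearMap.id ℝ _) x := by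
    rw [← hPL, hL, fderivWithin_of_mem_nhds hxn]
    exact P'.hasStrictFDerivAt.comp x (hsm.hasStrictFDerivAt (by simp))
  have hmap := hst.map_nhds_eq_of_surj (by simp)
  have hN : cubeExt s ⁻¹' φ.source ∈ 𝓝 x :=
    ((hs x hxI).continuousWithinAt.continuousAt hxn).preimage_mem_nhds
      (φ.open_source.mem_nhds hsx)
  have himg : (fun q => P' (φ (cubeExt s q))) '' (cubeExt s ⁻¹' φ.source) ∈
      𝓝 (P' (φ (cubeExt s x))) := by
    rw [← hmap]
    exact Filter.image_mem_map hN
  have hd1 := Real.dimH_of_mem_nhds himg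
  have hsub : (fun q => P' (φ (cubeExt s q))) '' (cubeExt s ⁻¹' φ.source) ⊆
      P' '' (φ '' (Y ∩ φ.source)) := by
    rintro _ ⟨q, hq, rfl⟩
    exact ⟨_, ⟨_, ⟨hsY _, hq⟩, rfl⟩, rfl⟩
  have hd2 := (dimH_mono hsub).trans (P'.lipschitz.dimH_image_le _)
  rw [hd1, Module.finrank_fin_fun] at hd2
  exact (hY φ hφ).not_ge hd2

end Dimension

/-! ### Dimension of the union of the cycles. -/

section FundamentalCycles

variable {E : Type*} [NormedAddCommGroup E] [NormedSpace ℂ E]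
variable {X : Type*} [TopologicalSpace X] [ChartedSpace E X]
variable {F₁ : Type*} [NormedAddCommGroup F₁] [NormedSpace ℂ F₁]
variable {Z₁ : Type*} [TopologicalSpace Z₁] [ChartedSpace F₁ Z₁]
variable {F₂ : Type*} [NormedAddCommGroup F₂] [NormedSpace ℂ F₂]
variable {Z₂ : Type*} [TopologicalSpace Z₂] [ChartedSpace F₂ Z₂]

theorem IsSmoothCube.comp {k : ℕ} {s : Cube k → Z₁} (hs : IsSmoothCube F₁ s) {g : Z₁ → X}
    (hg : ContMDiff 𝓘(ℝ, F₁) 𝓘(ℝ, E) ∞ g) : IsSmoothCube E (g ∘ s) :=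
  hg.comp_contMDiffOn hs

/-- The union `Y_t` of the images of the fibres has real dimension at most `2n`. -/
theorem dimH_chart_image_unionFibre_lt [IsManifold 𝓘(ℝ, E) ∞ X] {n : ℕ} {π : X → ℂ}
    {g₁ : Z₁ → X} {g₂ : Z₂ → X} (hg₁ : ContMDiff 𝓘(ℝ, F₁) 𝓘(ℝ, E) ∞ g₁)
    (hg₂ : ContMDiff 𝓘(ℝ, F₂) 𝓘(ℝ, E) ∞ g₂) {t : ℂ} {c₁ : Chain (2 * n) Z₁}
    {c₂ : Chain (2 * n) Z₂} (hc₁ : IsFundamentalCycle F₁ (fibre (π ∘ g₁) t) c₁)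
    (hc₂ : IsFundamentalCycle F₂ (fibre (π ∘ g₂) t) c₂) {φ : OpenPartialHomeomorph X E}
    (hφ : φ ∈ atlas E X) :
    dimH (φ '' (unionFibre π g₁ g₂ t ∩ φ.source)) < ((2 * n + 1 : ℕ) : ENNReal) := by
  obtain ⟨-, N₁, s₁, -, -, hs₁, hA₁, -⟩ := hc₁
  obtain ⟨-, N₂, s₂, -, -, hs₂, hA₂, -⟩ := hc₂
  have h₁ := dimH_chart_image_le hφ fun l => (hs₁ l).comp hg₁
  have h₂ := dimH_chart_image_le hφ fun l => (hs₂ l).comp hg₂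
  simp only [range_comp, ← image_iUnion, hA₁, hA₂] at h₁ h₂
  rw [unionFibre, union_inter_distrib_right, image_union, dimH_union]
  exact (max_le h₁ h₂).trans_lt (by exact_mod_cast Nat.lt_succ_self (2 * n))

end FundamentalCycles

/-! ### The derivative for a smooth family of chains. -/

section FamilyDerivative

variable {E : Type*} [NormedAddCommGroup E] [NormedSpace ℂ E]
variable {X : Type*} [TopologicalSpace X] [ChartedSpace E X] [IsManifold 𝓘(ℝ, E) ∞ X]
variable {F₁ : Type*} [NormedAddCommGroup F₁] [NormedSpace ℂ F₁]
variable {Z₁ : Type*} [TopologicalSpace Z₁] [ChartedSpace F₁ Z₁] [IsManifold 𝓘(ℝ, F₁) ∞ Z₁]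
variable {F₂ : Type*} [NormedAddCommGroup F₂] [NormedSpace ℂ F₂]
variable {Z₂ : Type*} [TopologicalSpace Z₂] [ChartedSpace F₂ Z₂] [IsManifold 𝓘(ℝ, F₂) ∞ Z₂]

/-- The derivative of the integral of `w` over a smooth family of chains bounded by the difference
of two families of cycles. -/
theorem hasDerivAt_familyIntegral {k : ℕ} {U : TopologicalSpace.Opens ℂ} {π : X → ℂ}
    (hπ : ContMDiff 𝓘(ℝ, E) 𝓘(ℝ, ℂ) ∞ π) {g₁ : Z₁ → X} {g₂ : Z₂ → X}
    (hg₁ : ContMDiff 𝓘(ℝ, F₁) 𝓘(ℝ, E) ∞ g₁) (hg₂ : ContMDiff 𝓘(ℝ, F₂) 𝓘(ℝ, E) ∞ g₂)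
    {σ : Chain (k + 1) (U → X)} {ζ₁ : Chain k (U → Z₁)} {ζ₂ : Chain k (U → Z₂)}
    (hσ : IsSmoothFamily E π σ) (hζ₁ : IsSmoothFamily F₁ (π ∘ g₁) ζ₁)
    (hζ₂ : IsSmoothFamily F₂ (π ∘ g₂) ζ₂) (hcyc₁ : IsCycle ζ₁) (hcyc₂ : IsCycle ζ₂)
    (hbd : ChainEq (boundary σ) (push (fun f => g₂ ∘ f) ζ₂ - push (fun f => g₁ ∘ f) ζ₁))
    {w η : DiffForm E X (k + 1)} {α₁ β₁ : DiffForm F₁ Z₁ k} {α₂ β₂ : DiffForm F₂ Z₂ k}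
    (hη : IsExtDerivDivBy π w η) (hβ₁ : IsRestrictionDivBy π g₁ w α₁ β₁)
    (hβ₂ : IsRestrictionDivBy π g₂ w α₂ β₂) (t : U) {a : ℂ}
    (hα : HasDerivAt (fun u => α₂.familyIntegral ζ₂ t u - α₁.familyIntegral ζ₁ t u) a t) :
    HasDerivAt (w.familyIntegral σ t)
      (η.integral (member σ t) + β₂.integral (member ζ₂ t) - β₁.integral (member ζ₁ t) + a) t := by
  have hd := (w.differentiableAt_familyIntegral hσ t).hasFDerivAt
  -- The real derivative of the difference of the `α`-integrals is multiplication by `a`.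
  have hα' := (hα.hasFDerivAt.restrictScalars ℝ).unique
    ((α₂.differentiableAt_familyIntegral hζ₂ t).hasFDerivAt.sub
      (α₁.differentiableAt_familyIntegral hζ₁ t).hasFDerivAt)
  -- It suffices that the real derivative agrees, in every direction `v`, with multiplication by the
  -- asserted number.
  refine hasDerivAt_iff_hasFDerivAt.2 (hasFDerivAt_of_restrictScalars ℝ hd ?_)
  ext1 v
  have hαv := congrArg (fun L : ℂ →L[ℝ] ℂ => L v) hα'
  simp only [sub_apply, ContinuousLinearMap.coe_restrictScalars',
    ContinuousLinearMap.toSpanSingleton_apply, smul_eq_mul] at hαv ⊢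
  rw [w.fderiv_familyIntegral_succ hσ t v, hη.extDerivFlux_eq hπ hσ t v,
    linearCombination_eq_of_chainEq (w.flux_of_isDegenerate t v) hbd, map_sub,
    hβ₁.flux_eq hπ hg₁ hζ₁ hcyc₁ t v, hβ₂.flux_eq hπ hg₂ hζ₂ hcyc₂ t v]
  linear_combination hαv

end FamilyDerivative

end Periods

end

/-! ### The derivative of the period. -/

theorem theorem2
    (n : ℕ)
    -- the total space of the family, a complex manifold of dimension `2n + 2`
    {E : Type*} [NormedAddCommGroup E] [NormedSpace ℂ E] [FiniteDimensional ℂ E]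
    (hE : Module.finrank ℂ E = 2 * n + 2)
    {X : Type*} [TopologicalSpace X] [T2Space X] [SecondCountableTopology X]
    [ChartedSpace E X] [IsManifold 𝓘(ℂ, E) ∞ X]
    -- the total spaces of the two families of cycles, complex manifolds of dimension `n + 1`
    {F₁ : Type*} [NormedAddCommGroup F₁] [NormedSpace ℂ F₁] [FiniteDimensional ℂ F₁]
    (hF₁ : Module.finrank ℂ F₁ = n + 1)
    {Z₁ : Type*} [TopologicalSpace Z₁] [T2Space Z₁] [SecondCountableTopology Z₁]
    [ChartedSpace F₁ Z₁] [IsManifold 𝓘(ℂ, F₁) ∞ Z₁]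
    {F₂ : Type*} [NormedAddCommGroup F₂] [NormedSpace ℂ F₂] [FiniteDimensional ℂ F₂]
    (hF₂ : Module.finrank ℂ F₂ = n + 1)
    {Z₂ : Type*} [TopologicalSpace Z₂] [T2Space Z₂] [SecondCountableTopology Z₂]
    [ChartedSpace F₂ Z₂] [IsManifold 𝓘(ℂ, F₂) ∞ Z₂]
    -- the proper holomorphic submersion `π : X → D`
    (D : Set ℂ) (hD : IsOpen D) (π : X → ℂ) (hπ : ContMDiff 𝓘(ℂ, E) 𝓘(ℂ, ℂ) ∞ π)
    (hπD : ∀ x, π x ∈ D) (hproper : IsProperMap fun x => (⟨π x, hπD x⟩ : D))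
    (hsubm : ∀ x, Function.Surjective (mfderiv 𝓘(ℂ, E) 𝓘(ℂ, ℂ) π x))
    -- the holomorphic maps of the families of cycles to `X`
    (g₁ : Z₁ → X) (hg₁ : ContMDiff 𝓘(ℂ, F₁) 𝓘(ℂ, E) ∞ g₁)
    (g₂ : Z₂ → X) (hg₂ : ContMDiff 𝓘(ℂ, F₂) 𝓘(ℂ, E) ∞ g₂)
    -- the fundamental cycles of `Z_{1,t}` and `Z_{2,t}` and the homology `δ_t` between them
    (z₁ : ℂ → Periods.Chain (2 * n) Z₁) (z₂ : ℂ → Periods.Chain (2 * n) Z₂)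
    (hz₁ : ∀ t ∈ D, Periods.IsFundamentalCycle F₁ (Periods.fibre (π ∘ g₁) t) (z₁ t))
    (hz₂ : ∀ t ∈ D, Periods.IsFundamentalCycle F₂ (Periods.fibre (π ∘ g₂) t) (z₂ t))
    (δ : ℂ → Periods.Chain (2 * n + 1) X)
    (hδ : Periods.IsHomologyBetween E F₁ F₂ D π g₁ g₂ z₁ z₂ δ)
    -- the forms `w` and `α = (α₁, α₂)`, with `dw = dt ∧ η` and `w|_Y - dα = dt ∧ β`
    (w η : Periods.DiffForm E X (2 * n + 1))
    (α₁ β₁ : Periods.DiffForm F₁ Z₁ (2 * n)) (α₂ β₂ : Periods.DiffForm F₂ Z₂ (2 * n))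
    (hη : Periods.IsExtDerivDivBy π w η)
    (hβ₁ : Periods.IsRestrictionDivBy π g₁ w α₁ β₁)
    (hβ₂ : Periods.IsRestrictionDivBy π g₂ w α₂ β₂)
    -- the integral of `α` over `Z_{2,t} - Z_{1,t}` depends holomorphically on `t`
    (hα : DifferentiableOn ℂ (fun t => α₂.integral (z₂ t) - α₁.integral (z₁ t)) D) :
    ∀ t ∈ D,
      HasDerivAt (fun u => w.integral (δ u))
        (η.integral (δ t) + β₂.integral (z₂ t) - β₁.integral (z₁ t) +
          deriv (fun u => α₂.integral (z₂ u) - α₁.integral (z₁ u)) t) t := by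
  open Periods in
  have := isManifold_real E X
  have := isManifold_real F₁ Z₁
  have := isManifold_real F₂ Z₂
  have hπ' := contMDiff_real hπ
  have hg₁' := contMDiff_real hg₁
  have hg₂' := contMDiff_real hg₂
  have hsurj := fun x => exists_fderiv_chart_symm_eq_one hπ (hsubm x)
  intro t₀ ht₀
  obtain ⟨U, ht₀U, hUD, σ, ζ₁, ζ₂, hσ, hζ₁, hζ₂, hcyc₁, hcyc₂, hbd, hU⟩ := hδ.2 t₀ ht₀
  set t : U := ⟨t₀, ht₀U⟩ with ht
  have hUn : (U : Set ℂ) ∈ 𝓝 t₀ := U.isOpen.mem_nhds ht₀U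
  have hvanish : ∀ (θ : DiffForm E X (2 * n + 1)) (u : U) (s : Cube (2 * n + 1) → X),
      IsSmoothCube E s → (∀ x, s x ∈ unionFibre π g₁ g₂ u) → θ.cubeIntegral s = 0 :=
    fun θ u s hs hsY => θ.cubeIntegral_eq_zero_of_dimH_lt (fun φ hφ =>
      dimH_chart_image_unionFibre_lt hg₁' hg₂' (hz₁ u (hUD u.2)) (hz₂ u (hUD u.2)) hφ) hs hsY
  -- The equality is needed for all `u` near `t₀` since it is differentiated; for `η` the point `t₀`
  -- suffices.
  have hw : ∀ u : U, w.integral (δ u) = w.familyIntegral σ t u := fun u =>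
    (w.integral_eq_of_relHomologous (fun τ hτ hτu x hx => by
      rw [hη.extDerivWithin_pull_eq_zero hπ' hτ hτu hx]; rfl) (hvanish w u) (hU u).2.2).trans
      (w.integral_member hσ t u)
  have hη_eq : η.integral (δ t) = η.integral (member σ t) :=
    η.integral_eq_of_relHomologous (fun τ hτ hτu x hx => by
      rw [hη.extDerivWithin_pull_quotient_eq_zero hπ' hsurj hτ hτu hx]; rfl)
      (hvanish η t) (hU t).2.2
  have hα' : HasDerivAt (fun u => α₂.familyIntegral ζ₂ t u - α₁.familyIntegral ζ₁ t u)
      (deriv (fun u => α₂.integral (z₂ u) - α₁.integral (z₁ u)) t₀) t := by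
    refine (hα.differentiableAt (hD.mem_nhds ht₀)).hasDerivAt.congr_of_eventuallyEq ?_
    filter_upwards [hUn] with u hu
    rw [(hU ⟨u, hu⟩).1, (hU ⟨u, hu⟩).2.1, α₁.integral_member hζ₁ t ⟨u, hu⟩,
      α₂.integral_member hζ₂ t ⟨u, hu⟩]
  have key := hasDerivAt_familyIntegral hπ' hg₁' hg₂' hσ hζ₁ hζ₂ hcyc₁ hcyc₂ hbd hη hβ₁ hβ₂ t hα'
  rw [← hη_eq, ← (hU t).1, ← (hU t).2.1] at key
  refine key.congr_of_eventuallyEq ?_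
  filter_upwards [hUn] with u hu
  exact hw ⟨u, hu⟩
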